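/- Let $\sigma>0$ and let $x_t=\mu_t+\varepsilon_t$, $t=1,\dots,T$, where $\varepsilon_1,\dots,\varepsilon_T$ are i.i.d. $N(0,\sigma^2)$ and the mean is piecewise constant with $m^*\ge 1$ changepoints $0=\tau_0<\tau_1<\dots<\tau_{m^*}<\tau_{m^*+1}=T$, that is, $\mu_t=\theta_j$ for $\tau_{j-1}<t\le\tau_j$, $j=1,\dots,m^*+1$. Put $\delta_T=\min_{1\le j\le m^*+1}(\tau_j-\tau_{j-1})$, let $\Delta_j=|\theta_{j+1}-\theta_j|/\sigma$ be the size of the $j$-th change in units of the noise standard deviation, and $\Delta_T=\min_{1\le j\le m^*}\Delta_j$. For a penalty $\beta>0$ let $(\hat m,\hat\tau_{1:\hat m})$ be any minimiser, over all $m\ge 0$ and all integers $0=\tau'_0<\tau'_1<\dots<\tau'_m<\tau'_{m+1}=T$, of the penalised cost $$\min_{\vartheta_1,\dots,\vartheta_{m+1}\in\mathbb R}\ \sum_{j=1}^{m+1}\ \sum_{t=\tau'_{j-1}+1}^{\tau'_j}\frac{(x_t-\vartheta_j)^2}{\sigma^2}+m\beta .$$ Theorem. For every $\varepsilon>0$ there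 is $T_0=T_0(\varepsilon)$ such that the following holds for all $T\ge T_0$ and all $m^*\ge1$, $\tau_{1:m^*}$, $\theta_{1:m^*+1}$ and $\sigma>0$ as above. If $\beta=(2+\varepsilon)\log T$, $$\delta_T\Delta_T^2\ge(16+10\varepsilon)\log T\qquad\text{and}\qquad \Delta_T^2\ge\frac{(32+20\varepsilon)\log T}{T^{1/(4m^*+3)}},$$ then $$\mathbb P\Big(\hat m=m^*\ \text{ and }\ \max_{1\le j\le m^*}|\hat\tau_j-\tau_j|\,\Delta_j^2\le(16+10\varepsilon)\log T\Big)\ \ge\ 1-(7m^*+3)\,T^{-\varepsilon/(32m^*+16)},$$ where the event is that every minimiser $(\hat m,\hat\tau_{1:\hat m})$ has the stated property. -/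

import Mathlib

open MeasureTheory ProbabilityTheory

noncomputable section

/-- `m` ordered changepoints `0 = τ 0 < τ 1 < ⋯ < τ m < τ (m + 1) = T` of the data `x 1, …, x T`.
Only the values `τ 0, …, τ (m + 1)` are relevant. The `j`-th segment, `1 ≤ j ≤ m + 1`, consists of
the indices `t` with `τ (j - 1) < t ≤ τ j`. -/
def IsSegmentation (T m : ℕ) (τ : ℕ → ℕ) : Prop :=
  τ 0 = 0 ∧ τ (m + 1) = T ∧ ∀ j ≤ m, τ j < τ (j + 1)

/-- The piecewise constant mean at time `t`: it is `θ (j + 1)` for `τ j < t ≤ τ (j + 1)`. -/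
def meanSignal (m : ℕ) (τ : ℕ → ℕ) (θ : ℕ → ℝ) (t : ℕ) : ℝ :=
  ∑ j ∈ Finset.range (m + 1), if τ j < t ∧ t ≤ τ (j + 1) then θ (j + 1) else 0

/-- Squared-error cost, with noise variance `σ ^ 2`, of fitting the constant `θ` to the data
`x (s + 1), …, x e`. -/
def segCost (σ : ℝ) (x : ℕ → ℝ) (s e : ℕ) (θ : ℝ) : ℝ :=
  ∑ t ∈ Finset.Ioc s e, (x t - θ) ^ 2 / σ ^ 2

/-- Cost of a segmentation: the minimum over all choices of the segment parameters
`θ 1, …, θ (m + 1)`, without constraints between them. -/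
def segmentationCost (σ : ℝ) (x : ℕ → ℝ) (m : ℕ) (τ : ℕ → ℕ) : ℝ :=
  ⨅ θ : ℕ → ℝ, ∑ j ∈ Finset.range (m + 1), segCost σ x (τ j) (τ (j + 1)) (θ (j + 1))

/-- The `L₀`-penalised cost with penalty `β` for every changepoint. -/
def penalisedCost (σ β : ℝ) (x : ℕ → ℝ) (m : ℕ) (τ : ℕ → ℕ) : ℝ :=
  segmentationCost σ x m τ + m * β

/-- `(m, τ)` minimises the penalised cost over all numbers and locations of changepoints. -/
def IsPenalisedMinimiser (T : ℕ) (σ β : ℝ) (x : ℕ → ℝ) (m : ℕ) (τ : ℕ → ℕ) : Prop :=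
  IsSegmentation T m τ ∧
    ∀ (m' : ℕ) (τ' : ℕ → ℕ), IsSegmentation T m' τ' →
      penalisedCost σ β x m τ ≤ penalisedCost σ β x m' τ'

/-- Size of the `j`-th change of mean, in units of the noise standard deviation `σ`. -/
def jumpSize (σ : ℝ) (θ : ℕ → ℝ) (j : ℕ) : ℝ :=
  |θ (j + 1) - θ j| / σ

/-- Smallest size of a change, over the changes `1, …, m` (used for `1 ≤ m` only). -/
def minJumpSize (σ : ℝ) (m : ℕ) (θ : ℕ → ℝ) : ℝ :=
  ⨅ j : Fin m, jumpSize σ θ ((j : ℕ) + 1)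

/-- Smallest length of a segment, over the segments `1, …, m + 1`. -/
def minSegmentLength (m : ℕ) (τ : ℕ → ℕ) : ℝ :=
  ⨅ j : Fin (m + 1), ((τ ((j : ℕ) + 1) : ℝ) - (τ (j : ℕ) : ℝ))

/-- The mean of `x (s + 1), …, x e`. -/
def segMean (x : ℕ → ℝ) (s e : ℕ) : ℝ :=
  (∑ t ∈ Finset.Ioc s e, x t) / ((e : ℝ) - (s : ℝ))

/-- The segment mean minimises the cost of a segment. -/
theorem segCost_segMean_le (σ : ℝ) (x : ℕ → ℝ) {s e : ℕ} (h : s < e) (θ : ℝ) :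
    segCost σ x s e (segMean x s e) ≤ segCost σ x s e θ := by
  have hse : (0 : ℝ) < (e : ℝ) - (s : ℝ) := sub_pos.2 (by exact_mod_cast h)
  have hsum : ∑ t ∈ Finset.Ioc s e, x t = segMean x s e * ((e : ℝ) - (s : ℝ)) := by
    rw [segMean, div_mul_cancel₀ _ hse.ne']
  have hcard : ((Finset.Ioc s e).card : ℝ) = (e : ℝ) - (s : ℝ) := by
    rw [Nat.card_Ioc, Nat.cast_sub h.le]
  have key : ∀ a : ℝ, ∑ t ∈ Finset.Ioc s e, (x t - a) ^ 2
      = ∑ t ∈ Finset.Ioc s e, (x t) ^ 2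
        - 2 * a * ∑ t ∈ Finset.Ioc s e, x t + ((e : ℝ) - (s : ℝ)) * a ^ 2 := by
    intro a
    have : ∀ t, (x t - a) ^ 2 = (x t) ^ 2 - 2 * a * x t + a ^ 2 := fun t => by ring
    simp only [this, Finset.sum_add_distrib, Finset.sum_sub_distrib, Finset.sum_const,
      nsmul_eq_mul, hcard, Finset.mul_sum]
  unfold segCost
  rw [← Finset.sum_div, ← Finset.sum_div, key, key, hsum]
  apply div_le_div_of_nonneg_right _ (sq_nonneg σ)
  nlinarith [mul_nonneg hse.le (sq_nonneg (segMean x s e - θ))]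

/-- The minimum in `segmentationCost` is attained at the segment means. -/
theorem segmentationCost_eq (T : ℕ) (σ : ℝ) (x : ℕ → ℝ) (m : ℕ) (τ : ℕ → ℕ)
    (h : IsSegmentation T m τ) :
    segmentationCost σ x m τ = ∑ j ∈ Finset.range (m + 1),
      segCost σ x (τ j) (τ (j + 1)) (segMean x (τ j) (τ (j + 1))) := by
  have hle : ∀ θ : ℕ → ℝ, ∑ j ∈ Finset.range (m + 1),
      segCost σ x (τ j) (τ (j + 1)) (segMean x (τ j) (τ (j + 1)))
        ≤ ∑ j ∈ Finset.range (m + 1), segCost σ x (τ j) (τ (j + 1)) (θ (j + 1)) := fun θ =>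
    Finset.sum_le_sum fun j hj =>
      segCost_segMean_le σ x (h.2.2 j (Nat.lt_succ_iff.1 (Finset.mem_range.1 hj))) _
  apply le_antisymm
  · exact ciInf_le ⟨_, by rintro _ ⟨θ, rfl⟩; exact hle θ⟩
      (fun j => segMean x (τ (j - 1)) (τ j))
  · exact le_ciInf hle

/-- The penalised cost has a minimiser. -/
theorem exists_isPenalisedMinimiser (T : ℕ) (hT : 0 < T) (σ β : ℝ) (x : ℕ → ℝ) :
    ∃ (m : ℕ) (τ : ℕ → ℕ), IsPenalisedMinimiser T σ β x m τ := by
  classical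
  -- segmentations whose irrelevant values are set to `T` form a finite set
  let S : Set (ℕ × (ℕ → ℕ)) :=
    {p | IsSegmentation T p.1 p.2 ∧ ∀ j, p.1 + 1 ≤ j → p.2 j = T}
  have hgrow : ∀ (m : ℕ) (τ : ℕ → ℕ), IsSegmentation T m τ → ∀ j ≤ m + 1, j ≤ τ j := by
    intro m τ h j
    induction j with
    | zero => intro _; exact Nat.zero_le _
    | succ k ih =>
      intro hk
      have h1 := ih (by omega)
      have h2 := h.2.2 k (by omega)
      omega
  have hmono : ∀ (m : ℕ) (τ : ℕ → ℕ), IsSegmentation T m τ → ∀ i j, i + j = m + 1 →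
      τ i ≤ T := by
    intro m τ h i j
    induction j generalizing i with
    | zero => intro hi; rw [show i = m + 1 by omega, h.2.1]
    | succ k ih =>
      intro hi
      exact (h.2.2 i (by omega)).le.trans (ih (i + 1) (by omega))
  have hfin : S.Finite := by
    let F : (Fin (T + 1) × (Fin (T + 1) → Fin (T + 1))) → ℕ × (ℕ → ℕ) := fun q =>
      (q.1, fun j => if hj : j < T + 1 then (q.2 ⟨j, hj⟩ : ℕ) else T)
    apply (Set.finite_range F).subset
    rintro ⟨m, τ⟩ ⟨h, ht⟩
    replace h : IsSegmentation T m τ := h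
    replace ht : ∀ j, m + 1 ≤ j → τ j = T := ht
    have hm : m + 1 ≤ T := by
      have := hgrow m τ h (m + 1) le_rfl
      rw [h.2.1] at this
      exact this
    have hτ : ∀ j, τ j ≤ T := by
      intro j
      by_cases hj : j ≤ m + 1
      · exact hmono m τ h j (m + 1 - j) (by omega)
      · exact (ht j (by omega)).le
    refine ⟨(⟨m, by omega⟩, fun j => ⟨τ j, Nat.lt_succ_iff.2 (hτ j)⟩), ?_⟩
    refine Prod.ext rfl (funext fun j => ?_)
    by_cases hj : j < T + 1
    · simp [F, hj]
    · simp only [F, hj, dif_neg, not_false_eq_true]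
      exact (ht j (by omega)).symm
  have hne : S.Nonempty :=
    ⟨(0, fun j => if j = 0 then 0 else T), ⟨by simp, by simp, by intro j hj; simp_all⟩,
      by intro j hj; simp only at hj ⊢; rw [if_neg (by omega)]⟩
  obtain ⟨⟨m, τ⟩, hS, hmin⟩ := Set.exists_min_image S
    (fun p : ℕ × (ℕ → ℕ) => penalisedCost σ β x p.1 p.2) hfin hne
  refine ⟨m, τ, hS.1, fun m' τ' h' => ?_⟩
  let τ'' : ℕ → ℕ := fun j => if j ≤ m' then τ' j else T
  have heq : ∀ j ≤ m' + 1, τ'' j = τ' j := by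
    intro j hj
    by_cases hj' : j ≤ m'
    · simp [τ'', hj']
    · rw [show j = m' + 1 by omega, h'.2.1]; simp [τ'']
  have h'' : IsSegmentation T m' τ'' := by
    refine ⟨by rw [heq 0 (by omega), h'.1], by rw [heq _ le_rfl, h'.2.1], fun j hj => ?_⟩
    rw [heq j (by omega), heq (j + 1) (by omega)]
    exact h'.2.2 j hj
  have hcost : penalisedCost σ β x m' τ'' = penalisedCost σ β x m' τ' := by
    unfold penalisedCost segmentationCost
    congr 1
    refine iInf_congr fun θ => Finset.sum_congr rfl fun j hj => ?_
    have := Finset.mem_range.1 hj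
    rw [heq j (by omega), heq (j + 1) (by omega)]
  have hS'' : (m', τ'') ∈ S := ⟨h'', by
    intro j hj
    simp only at hj
    simp only [τ'']
    rw [if_neg (by omega)]⟩
  rw [← hcost]
  exact hmin (m', τ'') hS''

end

/-!
The proof compares a fitted signal with the true mean cell by cell. With `z` the standardised noise
and `g` the error of the fit, both in units of `σ`, the fit changes the cost of the true mean by
`∑ (g t ^ 2 - 2 * g t * z t)`, the *excess*. A minimiser of the penalised cost has penalised excess at
most that of the true changepoints, and the excess is additive over time.

The time axis is cut into windows of half-width `h j = (8 + 5 ε) log T / Δ j ^ 2` around the true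
changepoints `τ j` and the cells between them. The condition on segment lengths ensures that these
windows do not overlap, provided that their endpoints may be real numbers. Therefore all sums over
time are treated as integrals of step functions (`stepIntegral`), and an observation may be shared
between two cells. On a piece where `g` is constant, the excess is at least `-S ^ 2 / length`, where
`S` is the noise sum over the piece. Hence lower bounds for the excess on a cell (`excess_cell_ge`)
and on a window (`excess_window_ge`) follow from bounds on normalised noise sums. If these hold, a
fit with the right number of changepoints on a cell gains little there, and any other number costs
at least `(1 + 3 ε / 8) log T`: without a changepoint in a window the excess is of the order of the
squared jump times `h j`, and a superfluous changepoint costs a penalty that exceeds what the noise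
can gain. Since the small gains add up to less than this, a minimiser has exactly one changepoint in
each window and none elsewhere (`changepoints_mem_windows`).

It remains to bound the noise sums (`IsNoise.exists_event_cellNoise`). The sums over the cells
between the windows and over the two halves of the windows are only `3 m + 1` in number, and the bounds `2 T ^ (-ε / (32 m + 16))` for their exceedance
probabilities make up most of the stated error probability. Sums between a window endpoint or centre
and an integer point of the window are covered by a union bound, which is affordable because the
second condition makes the windows at most `T ^ (1 / (4 m + 3))` long. For arbitrary intervals a
union bound over both endpoints would be too expensive at the level `(2 + ε) log T`. Instead Doob's
maximal inequality is used on geometrically growing ranges of lengths, so that only one endpoint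
enters the union bound.
-/

/-! ### Integrals of step functions -/

/-- The length of `(t - 1, t] ∩ (-∞, x]`: the weight of the time point `t` in the interval `(0, x]`
with a real endpoint `x`. -/
noncomputable def clip (x : ℝ) (t : ℕ) : ℝ := max 0 (min 1 (x - t + 1))

/-- The integral over `(0, x]` of the step function equal to `h t` on `(t - 1, t]`, `1 ≤ t ≤ T`. -/
noncomputable def stepIntegral (T : ℕ) (h : ℕ → ℝ) (x : ℝ) : ℝ :=
  ∑ t ∈ Finset.Icc 1 T, clip x t * h t

theorem clip_nonneg (x : ℝ) (t : ℕ) : 0 ≤ clip x t := le_max_left _ _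

theorem clip_le_one (x : ℝ) (t : ℕ) : clip x t ≤ 1 :=
  max_le zero_le_one (min_le_left _ _)

theorem clip_mono {a b : ℝ} (h : a ≤ b) (t : ℕ) : clip a t ≤ clip b t := by
  unfold clip; gcongr

theorem clip_of_le {x : ℝ} {t : ℕ} (h : (t : ℝ) ≤ x) : clip x t = 1 := by
  unfold clip
  rw [min_eq_left (by linarith), max_eq_right zero_le_one]

theorem clip_of_ge {x : ℝ} {t : ℕ} (h : x + 1 ≤ (t : ℝ)) : clip x t = 0 := by
  unfold clip
  exact max_eq_left ((min_le_right _ _).trans (by linarith))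

theorem sum_clip_eq_min {x : ℝ} (hx : 0 ≤ x) (T : ℕ) :
    ∑ t ∈ Finset.Icc 1 T, clip x t = min x T := by
  induction T with
  | zero => simp [hx]
  | succ T ih =>
    rw [Finset.sum_Icc_succ_top (by omega), ih]
    unfold clip
    push_cast
    rcases le_total x T with h | h
    · rw [min_eq_left h, min_eq_left (by linarith : x ≤ (T : ℝ) + 1),
        max_eq_left ((min_le_right _ _).trans (by linarith)), add_zero]
    · rw [min_eq_right h]
      rcases le_total x (T + 1) with h' | h'
      · rw [min_eq_left h', min_eq_right (by linarith), max_eq_right (by linarith)]; ring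
      · rw [min_eq_right h', min_eq_left (by linarith), max_eq_right (by linarith)]

theorem stepIntegral_const {T : ℕ} {x : ℝ} (hx : 0 ≤ x) (hxT : x ≤ T) (c : ℝ) :
    stepIntegral T (fun _ => c) x = x * c := by
  rw [stepIntegral, ← Finset.sum_mul, sum_clip_eq_min hx, min_eq_left hxT]

theorem stepIntegral_natCast (T : ℕ) (h : ℕ → ℝ) {n : ℕ} (hn : n ≤ T) :
    stepIntegral T h n = ∑ t ∈ Finset.Ioc 0 n, h t := by
  have hsub : Finset.Ioc 0 n ⊆ Finset.Icc 1 T := by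
    intro t; simp only [Finset.mem_Ioc, Finset.mem_Icc]; omega
  rw [stepIntegral, ← Finset.sum_subset hsub]
  · refine Finset.sum_congr rfl fun t ht => ?_
    rw [clip_of_le (by exact_mod_cast (Finset.mem_Ioc.1 ht).2), one_mul]
  · intro t ht ht'
    simp only [Finset.mem_Ioc, Finset.mem_Icc] at ht ht'
    rw [clip_of_ge (by exact_mod_cast (by omega : n + 1 ≤ t)), zero_mul]

/-- The integral over `(a, b]` depends only on the values at the `t` with `(t - 1, t]` meeting
`(a, b]`. -/
theorem stepIntegral_sub_congr {T : ℕ} {h h' : ℕ → ℝ} {a b : ℝ} (hab : a ≤ b)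
    (H : ∀ t : ℕ, a < t → (t : ℝ) < b + 1 → h t = h' t) :
    stepIntegral T h b - stepIntegral T h a = stepIntegral T h' b - stepIntegral T h' a := by
  simp only [stepIntegral, ← Finset.sum_sub_distrib]
  refine Finset.sum_congr rfl fun t _ => ?_
  rcases le_or_gt (t : ℝ) a with h1 | h1
  · rw [clip_of_le h1, clip_of_le (h1.trans hab)]; ring
  · rcases lt_or_ge (t : ℝ) (b + 1) with h2 | h2
    · rw [H t h1 h2]
    · rw [clip_of_ge h2, clip_of_ge (by linarith)]; ring

/-- `stepIntegral` interpolates linearly between consecutive integers. -/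
theorem stepIntegral_interp (T : ℕ) (h : ℕ → ℝ) {n : ℕ} {x : ℝ} (h1 : (n : ℝ) ≤ x)
    (h2 : x ≤ n + 1) :
    stepIntegral T h x =
      (n + 1 - x) * stepIntegral T h n + (x - n) * stepIntegral T h (n + 1 : ℕ) := by
  simp only [stepIntegral, Finset.mul_sum, ← Finset.sum_add_distrib]
  refine Finset.sum_congr rfl fun t _ => ?_
  rcases lt_trichotomy t (n + 1) with ht | ht | ht
  · have : (t : ℝ) ≤ n := by exact_mod_cast Nat.lt_succ_iff.1 ht
    rw [clip_of_le (this.trans h1), clip_of_le this, clip_of_le (by push_cast; linarith)]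
    ring
  · subst ht
    rw [clip_of_ge (x := (n : ℝ)) (by push_cast; linarith), clip_of_le le_rfl]
    unfold clip
    push_cast
    rw [min_eq_right (by linarith), max_eq_right (by linarith)]
    ring
  · have : (n : ℝ) + 2 ≤ t := by exact_mod_cast ht
    rw [clip_of_ge (x := x) (by linarith), clip_of_ge (x := (n : ℝ)) (by linarith),
      clip_of_ge (by push_cast; linarith)]
    ring

/-- By convexity of the square, a bound `S ^ 2 ≤ y * length` for the intervals between an integer
`u` and the two integers surrounding `a` passes to the interval with endpoint `a`. -/
theorem sq_stepIntegral_sub_le_of_nat {T : ℕ} {h : ℕ → ℝ} {a y : ℝ} (ha : 0 ≤ a) {u : ℕ}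
    (H : ∀ n : ℕ, n = ⌊a⌋₊ ∨ n = ⌊a⌋₊ + 1 →
      (n ≤ u → (stepIntegral T h u - stepIntegral T h n) ^ 2 ≤ y * (u - n)) ∧
      (u ≤ n → n ≤ T → (stepIntegral T h n - stepIntegral T h u) ^ 2 ≤ y * (n - u))) :
    (a ≤ u → (stepIntegral T h u - stepIntegral T h a) ^ 2 ≤ y * (u - a)) ∧
    (u ≤ a → a ≤ T → (stepIntegral T h a - stepIntegral T h u) ^ 2 ≤ y * (a - u)) := by
  set n := ⌊a⌋₊ with hn
  have h1 : (n : ℝ) ≤ a := Nat.floor_le ha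
  have h2 : a ≤ n + 1 := (Nat.lt_floor_add_one a).le
  have key : ∀ p q P Q c d : ℝ, 0 ≤ c → 0 ≤ d → c + d = 1 → p ^ 2 ≤ y * P → q ^ 2 ≤ y * Q →
      (c * p + d * q) ^ 2 ≤ y * (c * P + d * Q) := by
    intro p q P Q c d hc hd hcd hp hq
    have e1 : (c * p + d * q) ^ 2 = c * p ^ 2 + d * q ^ 2 - c * d * (p - q) ^ 2 := by
      have : d = 1 - c := by linarith
      subst this; ring
    have := mul_nonneg (mul_nonneg hc hd) (sq_nonneg (p - q))
    nlinarith [mul_le_mul_of_nonneg_left hp hc, mul_le_mul_of_nonneg_left hq hd]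
  have hI := stepIntegral_interp T h h1 h2
  constructor
  · intro hau
    rcases (by exact_mod_cast h1.trans hau : n ≤ u).eq_or_lt with e | hlt
    · have : a = u := le_antisymm hau (by rw [← e]; exact h1)
      rw [this]; simp
    · have := key _ _ _ _ (n + 1 - a) (a - n) (by linarith) (by linarith) (by ring)
        ((H n (Or.inl rfl)).1 hlt.le) ((H (n + 1) (Or.inr rfl)).1 hlt)
      convert this using 1
      · rw [hI]; ring
      · push_cast; ring
  · intro hua haT
    have hun : u ≤ n := Nat.le_floor hua
    rcases (by exact_mod_cast h1.trans haT : n ≤ T).eq_or_lt with e | hlt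
    · have : a = n := le_antisymm (by rw [e]; exact haT) h1
      rw [this]; exact (H n (Or.inl rfl)).2 hun e.le
    · have := key _ _ _ _ (n + 1 - a) (a - n) (by linarith) (by linarith) (by ring)
        ((H n (Or.inl rfl)).2 hun hlt.le) ((H (n + 1) (Or.inr rfl)).2 (by omega) hlt)
      convert this using 1
      · rw [hI]; ring
      · push_cast; ring

/-! ### The excess cost of a fit on one cell -/

/-- Index of the last of the changepoints `τ 0, …, τ m` in `[0, x]`. -/
noncomputable def lastIndex (m : ℕ) (τ : ℕ → ℕ) (x : ℝ) : ℕ :=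
  open Classical in Nat.findGreatest (fun i => (τ i : ℝ) ≤ x) m

theorem lastIndex_le (m : ℕ) (τ : ℕ → ℕ) (x : ℝ) : lastIndex m τ x ≤ m := by
  classical
  exact Nat.findGreatest_le _

theorem le_lastIndex {m : ℕ} {τ : ℕ → ℕ} {x : ℝ} {i : ℕ} (hi : i ≤ m) (h : (τ i : ℝ) ≤ x) :
    i ≤ lastIndex m τ x := by
  classical
  exact Nat.le_findGreatest hi h

theorem apply_lastIndex_le {T m : ℕ} {τ : ℕ → ℕ} (hτ : IsSegmentation T m τ) {x : ℝ}
    (hx : 0 ≤ x) : (τ (lastIndex m τ x) : ℝ) ≤ x := by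
  classical
  exact Nat.findGreatest_spec (P := fun i => (τ i : ℝ) ≤ x) (Nat.zero_le m) (by simp [hτ.1, hx])

theorem lt_apply_of_lastIndex_lt {m : ℕ} {τ : ℕ → ℕ} {x : ℝ} {i : ℕ} (hi : i ≤ m)
    (h : lastIndex m τ x < i) : x < τ i := by
  by_contra hx
  exact absurd (le_lastIndex hi (not_lt.1 hx)) (by omega)

theorem le_apply_lastIndex_succ {T m : ℕ} {τ : ℕ → ℕ} (hτ : IsSegmentation T m τ) {x : ℝ}
    (hx : x ≤ T) : x ≤ τ (lastIndex m τ x + 1) := by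
  rcases (lastIndex_le m τ x).eq_or_lt with h | h
  · rw [h, hτ.2.1]; exact hx
  · exact (lt_apply_of_lastIndex_lt h (Nat.lt_succ_self _)).le

theorem lastIndex_mono {T m : ℕ} {τ : ℕ → ℕ} (hτ : IsSegmentation T m τ) {a b : ℝ}
    (ha : 0 ≤ a) (hab : a ≤ b) : lastIndex m τ a ≤ lastIndex m τ b :=
  le_lastIndex (lastIndex_le _ _ _) ((apply_lastIndex_le hτ ha).trans hab)

theorem IsSegmentation.apply_le_apply {T m : ℕ} {τ : ℕ → ℕ} (hτ : IsSegmentation T m τ)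
    {i j : ℕ} (hij : i ≤ j) (hj : j ≤ m + 1) : τ i ≤ τ j := by
  induction j, hij using Nat.le_induction with
  | base => exact le_rfl
  | succ k _ ih => exact (ih (by omega)).trans (hτ.2.2 k (by omega)).le

theorem IsSegmentation.apply_le {T m : ℕ} {τ : ℕ → ℕ} (hτ : IsSegmentation T m τ)
    {i : ℕ} (hi : i ≤ m + 1) : τ i ≤ T := hτ.2.1 ▸ hτ.apply_le_apply hi le_rfl

theorem meanSignal_eq {T m : ℕ} {τ : ℕ → ℕ} (hτ : IsSegmentation T m τ) (θ : ℕ → ℝ) {i t : ℕ}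
    (hi : i ≤ m) (h1 : τ i < t) (h2 : t ≤ τ (i + 1)) : meanSignal m τ θ t = θ (i + 1) := by
  rw [meanSignal, Finset.sum_eq_single_of_mem i (Finset.mem_range.2 (by omega)), if_pos ⟨h1, h2⟩]
  intro j hj hji
  have hj' := Finset.mem_range.1 hj
  refine if_neg fun h => ?_
  rcases lt_or_gt_of_ne hji with hlt | hlt
  · have := hτ.apply_le_apply (i := j + 1) (j := i) hlt (by omega)
    omega
  · have := hτ.apply_le_apply (i := i + 1) (j := j) hlt (by omega)
    omega

/-- Increase of the squared error at time `t`, in units of the noise variance, when the true mean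
`μ` is replaced by the fit `f` and `z` is the standardised noise. -/
def excess (f μ z : ℕ → ℝ) (t : ℕ) : ℝ := (f t - μ t) ^ 2 - 2 * (f t - μ t) * z t

theorem stepIntegral_excess_sub {T : ℕ} {f μ z : ℕ → ℝ} {a b c : ℝ} (ha : 0 ≤ a) (hab : a ≤ b)
    (hb : b ≤ T) (hc : ∀ t : ℕ, a < t → (t : ℝ) < b + 1 → f t - μ t = c) :
    stepIntegral T (excess f μ z) b - stepIntegral T (excess f μ z) a =
      (b - a) * c ^ 2 - 2 * c * (stepIntegral T z b - stepIntegral T z a) := by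
  rw [stepIntegral_sub_congr (h' := fun t => c ^ 2 - 2 * c * z t) hab
    (fun t h1 h2 => by rw [excess, hc t h1 h2])]
  have : ∀ x : ℝ, stepIntegral T (fun t => c ^ 2 - 2 * c * z t) x
      = stepIntegral T (fun _ => c ^ 2) x - 2 * c * stepIntegral T z x := by
    intro x
    simp only [stepIntegral, Finset.mul_sum, ← Finset.sum_sub_distrib]
    exact Finset.sum_congr rfl fun t _ => by ring
  rw [this, this, stepIntegral_const (ha.trans hab) hb, stepIntegral_const ha (hab.trans hb)]
  ring

/-- Where the error of the fit is constant, the excess cost is at least minus the squared noise sum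
divided by the length, whatever the constant. -/
theorem neg_le_stepIntegral_excess_sub {T : ℕ} {f μ z : ℕ → ℝ} {a b c y : ℝ} (ha : 0 ≤ a)
    (hab : a ≤ b) (hb : b ≤ T) (hy : 0 ≤ y)
    (hc : ∀ t : ℕ, a < t → (t : ℝ) < b + 1 → f t - μ t = c)
    (hS : (stepIntegral T z b - stepIntegral T z a) ^ 2 ≤ y * (b - a)) :
    -y ≤ stepIntegral T (excess f μ z) b - stepIntegral T (excess f μ z) a := by
  rw [stepIntegral_excess_sub ha hab hb hc]
  rcases hab.eq_or_lt with rfl | hlt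
  · simp [hy]
  · set S := stepIntegral T z b - stepIntegral T z a
    have hw : 0 < b - a := by linarith
    by_contra hneg
    push Not at hneg
    nlinarith [mul_lt_mul_of_pos_left hneg hw, sq_nonneg ((b - a) * c - S)]

/-- Bounds for the noise on the cell `(a, b]`: each squared noise sum is at most a constant times
the length of the interval. The constant is `F` for the whole cell, `A` for the intervals that share
an endpoint with the cell and have an integer as their other endpoint, and `B` for the intervals
between integers. -/
structure CellNoise (T : ℕ) (z : ℕ → ℝ) (a b F A B : ℝ) : Prop where
  whole : (stepIntegral T z b - stepIntegral T z a) ^ 2 ≤ F * (b - a)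
  initial : ∀ u : ℕ, a ≤ u → (u : ℝ) ≤ b →
    (stepIntegral T z u - stepIntegral T z a) ^ 2 ≤ A * (u - a)
  final : ∀ u : ℕ, a ≤ u → (u : ℝ) ≤ b →
    (stepIntegral T z b - stepIntegral T z u) ^ 2 ≤ A * (b - u)
  interior : ∀ u v : ℕ, a ≤ u → u ≤ v → (v : ℝ) ≤ b →
    (stepIntegral T z v - stepIntegral T z u) ^ 2 ≤ B * (v - u)

/-- Lower bound for the excess cost of a fitted signal on a cell `(a, b]` without changes of the
mean. Without fitted changepoints only the noise on the whole cell enters; otherwise there are a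
first and a last piece, anchored at the ends of the cell, and pieces between consecutive fitted
changepoints. -/
theorem excess_cell_ge {T m : ℕ} {τ : ℕ → ℕ} (hτ : IsSegmentation T m τ) {φ μ z : ℕ → ℝ}
    {a b c F A B : ℝ} (ha : 0 ≤ a) (hab : a ≤ b) (hb : b ≤ T)
    (hF0 : 0 ≤ F) (hA0 : 0 ≤ A) (hB0 : 0 ≤ B)
    (hμ : ∀ t : ℕ, a < t → (t : ℝ) < b + 1 → μ t = c)
    (hz : CellNoise T z a b F A B) :
    (lastIndex m τ b = lastIndex m τ a →
      -F ≤ stepIntegral T (excess (meanSignal m τ φ) μ z) b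
        - stepIntegral T (excess (meanSignal m τ φ) μ z) a) ∧
    (∀ k : ℕ, lastIndex m τ b = lastIndex m τ a + (k + 1) →
      -(2 * A + k * B) ≤ stepIntegral T (excess (meanSignal m τ φ) μ z) b
        - stepIntegral T (excess (meanSignal m τ φ) μ z) a) := by
  set p := lastIndex m τ a with hp
  have hpm : p ≤ m := lastIndex_le _ _ _
  have hqm : lastIndex m τ b ≤ m := lastIndex_le _ _ _
  have hpa : (τ p : ℝ) ≤ a := apply_lastIndex_le hτ ha
  have hqb : (τ (lastIndex m τ b) : ℝ) ≤ b := apply_lastIndex_le hτ (ha.trans hab)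
  have hbq : b ≤ τ (lastIndex m τ b + 1) := le_apply_lastIndex_succ hτ hb
  have hfit : ∀ i ≤ m, ∀ x y : ℝ, a ≤ x → y ≤ b → (τ i : ℝ) ≤ x → y ≤ τ (i + 1) →
      ∀ t : ℕ, x < t → (t : ℝ) < y + 1 → meanSignal m τ φ t - μ t = φ (i + 1) - c := by
    intro i hi x y hax hyb hx hy t h1 h2
    rw [hμ t (hax.trans_lt h1) (h2.trans_le (by linarith)), meanSignal_eq hτ φ hi
      (by exact_mod_cast hx.trans_lt h1)
      (Nat.lt_succ_iff.1 (by exact_mod_cast h2.trans_le (by linarith : y + 1 ≤ τ (i + 1) + 1)))]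
  constructor
  · intro hq
    rw [hq] at hbq
    exact neg_le_stepIntegral_excess_sub ha hab hb hF0 (hfit p hpm a b le_rfl le_rfl hpa hbq)
      hz.whole
  · intro k hk
    have hgt : ∀ i, p < i → i ≤ m → a < τ i := fun i h1 h2 => lt_apply_of_lastIndex_lt h2 h1
    have hle : ∀ i, i ≤ p + (k + 1) → (τ i : ℝ) ≤ b := by
      intro i hi
      refine le_trans ?_ hqb
      exact_mod_cast hτ.apply_le_apply (by omega) (by omega)
    have hchain : ∀ n ≤ k, -(A + n * B) ≤
        stepIntegral T (excess (meanSignal m τ φ) μ z) (τ (p + 1 + n))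
          - stepIntegral T (excess (meanSignal m τ φ) μ z) a := by
      intro n
      induction n with
      | zero =>
        intro _
        have h1 := hgt (p + 1) (by omega) (by omega)
        have h2 := hle (p + 1) (by omega)
        have := neg_le_stepIntegral_excess_sub ha h1.le (h2.trans hb) hA0
          (hfit p hpm a _ le_rfl h2 hpa le_rfl) (hz.initial _ h1.le h2)
        simpa using this
      | succ n ih =>
        intro hn
        have h0 := ih (by omega)
        have h1 := hgt (p + 1 + n) (by omega) (by omega)
        have h2 := hle (p + 1 + n + 1) (by omega)
        have h3 : τ (p + 1 + n) ≤ τ (p + 1 + n + 1) := (hτ.2.2 _ (by omega)).le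
        have h3' : (τ (p + 1 + n) : ℝ) ≤ τ (p + 1 + n + 1) := by exact_mod_cast h3
        have := neg_le_stepIntegral_excess_sub (ha.trans h1.le) h3' (h2.trans hb) hB0
          (hfit (p + 1 + n) (by omega) _ _ h1.le h2 le_rfl le_rfl) (hz.interior _ _ h1.le h3 h2)
        rw [show p + 1 + (n + 1) = p + 1 + n + 1 by ring]
        push_cast
        linarith
    have h0 := hchain k le_rfl
    rw [show p + 1 + k = p + (k + 1) by ring] at h0
    rw [hk] at hbq hqb
    have h1 := hgt (p + (k + 1)) (by omega) (by omega)
    have := neg_le_stepIntegral_excess_sub (ha.trans h1.le) hqb hb hA0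
      (hfit (p + (k + 1)) (by omega) _ _ h1.le le_rfl le_rfl hbq) (hz.final _ h1.le hqb)
    linarith

/-! ### The excess cost near a change of the mean -/

/-- Lower bounds for the excess cost on the window `(c - h, c + h]` around a change of the mean at
`c`, according to the number of fitted changepoints in the window. -/
theorem excess_window_ge {T m : ℕ} {τ : ℕ → ℕ} (hτ : IsSegmentation T m τ) {φ μ z : ℕ → ℝ}
    {c : ℕ} {h ν₁ ν₂ F A D B : ℝ} (hh : 0 ≤ h) (ha : 0 ≤ (c : ℝ) - h) (hb : (c : ℝ) + h ≤ T)
    (hF0 : 0 ≤ F) (hA0 : 0 ≤ A) (hD0 : 0 ≤ D) (hB0 : 0 ≤ B) (hAB : 2 * A ≤ B)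
    (hμ₁ : ∀ t : ℕ, (c : ℝ) - h < t → (t : ℝ) < c + 1 → μ t = ν₁)
    (hμ₂ : ∀ t : ℕ, (c : ℝ) < t → (t : ℝ) < c + h + 1 → μ t = ν₂)
    (hlA : CellNoise T z (c - h) c F A B) (hlD : CellNoise T z (c - h) c F D B)
    (hrA : CellNoise T z c (c + h) F A B) (hrD : CellNoise T z c (c + h) F D B) :
    (lastIndex m τ (c + h) = lastIndex m τ (c - h) →
      3 / 8 * (h * (ν₂ - ν₁) ^ 2) - 8 * F ≤
        stepIntegral T (excess (meanSignal m τ φ) μ z) (c + h)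
          - stepIntegral T (excess (meanSignal m τ φ) μ z) (c - h)) ∧
    (lastIndex m τ (c + h) = lastIndex m τ (c - h) + 1 →
      -(F + 2 * D) ≤ stepIntegral T (excess (meanSignal m τ φ) μ z) (c + h)
          - stepIntegral T (excess (meanSignal m τ φ) μ z) (c - h)) ∧
    (∀ k : ℕ, lastIndex m τ (c + h) = lastIndex m τ (c - h) + (k + 2) →
      -(F + 2 * A + (k + 1) * B) ≤ stepIntegral T (excess (meanSignal m τ φ) μ z) (c + h)
          - stepIntegral T (excess (meanSignal m τ φ) μ z) (c - h)) := by
  have hac : (c : ℝ) - h ≤ c := by linarith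
  have hcb : (c : ℝ) ≤ c + h := by linarith
  have hc0 : (0 : ℝ) ≤ c := Nat.cast_nonneg _
  have hcT : (c : ℝ) ≤ T := by linarith
  have m1 := lastIndex_mono hτ ha hac
  have m2 := lastIndex_mono hτ hc0 hcb
  have lA := excess_cell_ge hτ (φ := φ) ha hac hcT hF0 hA0 hB0 hμ₁ hlA
  have lD := excess_cell_ge hτ (φ := φ) ha hac hcT hF0 hD0 hB0 hμ₁ hlD
  have rA := excess_cell_ge hτ (φ := φ) hc0 hcb hb hF0 hA0 hB0 hμ₂ hrA
  have rD := excess_cell_ge hτ (φ := φ) hc0 hcb hb hF0 hD0 hB0 hμ₂ hrD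
  refine ⟨fun hk => ?_, fun hk => ?_, fun k hk => ?_⟩
  · -- the fit is constant on the window, so its errors on the two halves differ by the jump
    set p := lastIndex m τ (c - h)
    have hpm : p ≤ m := lastIndex_le _ _ _
    have hpa : (τ p : ℝ) ≤ c - h := apply_lastIndex_le hτ ha
    have hbq : (c : ℝ) + h ≤ τ (p + 1) := hk ▸ le_apply_lastIndex_succ hτ hb
    have hfit : ∀ t : ℕ, (c : ℝ) - h < t → (t : ℝ) < c + h + 1 →
        meanSignal m τ φ t = φ (p + 1) := fun t h1 h2 =>
      meanSignal_eq hτ φ hpm (by exact_mod_cast hpa.trans_lt h1)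
        (Nat.lt_succ_iff.1 (by
          exact_mod_cast h2.trans_le (by linarith : (c : ℝ) + h + 1 ≤ τ (p + 1) + 1)))
    have e1 := stepIntegral_excess_sub (f := meanSignal m τ φ) (μ := μ) (z := z)
      (c := φ (p + 1) - ν₁) ha hac hcT
      (fun t h1 h2 => by rw [hfit t h1 (by linarith), hμ₁ t h1 h2])
    have e2 := stepIntegral_excess_sub (f := meanSignal m τ φ) (μ := μ) (z := z)
      (c := φ (p + 1) - ν₂) hc0 hcb hb
      (fun t h1 h2 => by rw [hfit t (by linarith) h2, hμ₂ t h1 h2])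
    have key : ∀ g S : ℝ, S ^ 2 ≤ F * h → 3 / 4 * (h * g ^ 2) - 4 * F ≤ h * g ^ 2 - 2 * g * S := by
      intro g S hS
      rcases hh.eq_or_lt with h0 | hpos
      · rw [← h0, mul_zero] at hS
        have : S = 0 := by nlinarith [sq_nonneg S]
        rw [← h0, this]; linarith
      · -- complete the square: `(1 / 4) h g ^ 2 - 2 g S + 4 F ≥ 0`
        by_contra hneg
        push Not at hneg
        nlinarith [mul_lt_mul_of_pos_left hneg hpos, sq_nonneg (h * g - 4 * S)]
    have wl := hlA.whole
    have wr := hrA.whole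
    rw [show (c : ℝ) - (c - h) = h by ring] at wl e1
    rw [show (c : ℝ) + h - c = h by ring] at wr e2
    have k1 := key (φ (p + 1) - ν₁) _ wl
    have k2 := key (φ (p + 1) - ν₂) _ wr
    have : h * (ν₂ - ν₁) ^ 2 ≤ 2 * (h * (φ (p + 1) - ν₁) ^ 2 + h * (φ (p + 1) - ν₂) ^ 2) := by
      nlinarith [mul_nonneg hh (sq_nonneg (φ (p + 1) - ν₁ + (φ (p + 1) - ν₂)))]
    linarith
  · rcases m1.eq_or_lt with h1 | h1
    · have := lD.1 h1.symm
      have := rD.2 0 (by omega)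
      push_cast at this
      linarith
    · have := lD.2 0 (by omega)
      have := rD.1 (by omega)
      push_cast at *
      linarith
  · rcases m1.eq_or_lt with h1 | h1
    · have := lA.1 h1.symm
      have := rA.2 (k + 1) (by omega)
      push_cast at this
      linarith
    · obtain ⟨i, hi⟩ := Nat.exists_eq_add_of_lt h1
      have l := lA.2 i (by omega)
      rcases m2.eq_or_lt with h2 | h2
      · obtain rfl : i = k + 1 := by omega
        have := rA.1 h2.symm
        push_cast at l
        linarith
      · obtain ⟨i', hi'⟩ := Nat.exists_eq_add_of_lt h2
        have r := rA.2 i' (by omega)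
        have : (i : ℝ) + i' = k := by exact_mod_cast (by omega : i + i' = k)
        have : (i : ℝ) * B + i' * B = k * B := by rw [← this]; ring
        linarith

/-! ### Recovery of the changepoints from bounds on the noise -/

/-- If the noise is bounded on the cells given by windows of half-widths `h j` around the true
changepoints, then a fit whose penalised excess cost is at most that of the true changepoints has
exactly one changepoint in each window and no others. On each cell the penalised excess cost is at
least a small negative number when the fit has the right number of changepoints there, and at least
`G` otherwise, where `G` exceeds the sum of the small numbers. -/
theorem changepoints_mem_windows {T m m' : ℕ} {τ τ' : ℕ → ℕ} (hτ : IsSegmentation T m τ)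
    (hτ' : IsSegmentation T m' τ') {θ φ z h : ℕ → ℝ} {F A D B β G J : ℝ}
    (h_zero : h 0 = 0) (h_last : h (m + 1) = 0) (h_nonneg : ∀ j, 0 ≤ h j)
    (h_sep : ∀ j ≤ m, h j + h (j + 1) ≤ (τ (j + 1) : ℝ) - τ j)
    (h_jump : ∀ j ∈ Finset.Icc 1 m, J ≤ h j * (θ (j + 1) - θ j) ^ 2)
    (hF0 : 0 ≤ F) (hA0 : 0 ≤ A) (hD0 : 0 ≤ D) (hAB : 2 * A ≤ B) (hBβ : B ≤ β)
    (hN : ∀ j ≤ m, CellNoise T z (τ j + h j) (τ (j + 1) - h (j + 1)) F A β)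
    (hlA : ∀ j ∈ Finset.Icc 1 m, CellNoise T z (τ j - h j) (τ j) F A B)
    (hlD : ∀ j ∈ Finset.Icc 1 m, CellNoise T z (τ j - h j) (τ j) F D B)
    (hrA : ∀ j ∈ Finset.Icc 1 m, CellNoise T z (τ j) (τ j + h j) F A B)
    (hrD : ∀ j ∈ Finset.Icc 1 m, CellNoise T z (τ j) (τ j + h j) F D B)
    (hG : (m + 1) * F + m * (F + 2 * D) < G) (hG₁ : G ≤ β - 2 * A)
    (hG₂ : G ≤ β - (F + 2 * A + B)) (hG₃ : G ≤ 3 / 8 * J - 8 * F - β)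
    (hmin : ∑ t ∈ Finset.Ioc 0 T, excess (meanSignal m' τ' φ) (meanSignal m τ θ) z t + m' * β
      ≤ m * β) :
    m' = m ∧ ∀ j ∈ Finset.Icc 1 m, |(τ' j : ℝ) - τ j| ≤ h j := by
  set SI := stepIntegral T (excess (meanSignal m' τ' φ) (meanSignal m τ θ) z) with hSI
  set p := lastIndex m' τ' with hp
  set V : ℝ → ℝ := fun x => SI x + p x * β with hV
  have hτ0 : τ 0 = 0 := hτ.1
  have hτT : τ (m + 1) = T := hτ.2.1
  have hB0 : 0 ≤ B := by linarith
  have hlo : ∀ j ∈ Finset.Icc 1 m, (0 : ℝ) ≤ τ j - h j ∧ (τ j : ℝ) + h j ≤ T := by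
    intro j hj
    obtain ⟨h1, h2⟩ := Finset.mem_Icc.1 hj
    obtain ⟨i, rfl⟩ : ∃ i, j = i + 1 := ⟨j - 1, by omega⟩
    have s1 := h_sep i (by omega)
    have s2 := h_sep (i + 1) h2
    have : (τ (i + 1 + 1) : ℝ) ≤ T := by exact_mod_cast hτ.apply_le (by omega)
    have : (0 : ℝ) ≤ τ i := Nat.cast_nonneg _
    have := h_nonneg i
    have := h_nonneg (i + 1 + 1)
    constructor <;> linarith
  have hμ : ∀ i ≤ m, ∀ t : ℕ, (τ i : ℝ) < t → (t : ℝ) < τ (i + 1) + 1 →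
      meanSignal m τ θ t = θ (i + 1) := fun i hi t h1 h2 =>
    meanSignal_eq hτ θ hi (by exact_mod_cast h1) (Nat.lt_succ_iff.1 (by exact_mod_cast h2))
  -- cells between the windows
  have incN : ∀ j ≤ m, -F ≤ V (τ (j + 1) - h (j + 1)) - V (τ j + h j) ∧
      (V (τ (j + 1) - h (j + 1)) - V (τ j + h j) < G →
        p (τ (j + 1) - h (j + 1)) = p (τ j + h j)) := by
    intro j hj
    have s := h_sep j hj
    have n1 := h_nonneg j
    have n2 := h_nonneg (j + 1)
    have t0 : (0 : ℝ) ≤ τ j := Nat.cast_nonneg _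
    have tT : (τ (j + 1) : ℝ) ≤ T := by exact_mod_cast hτ.apply_le (by omega)
    have cell := excess_cell_ge hτ' (φ := φ) (a := τ j + h j) (b := τ (j + 1) - h (j + 1))
      (by linarith) (by linarith) (by linarith) hF0 hA0 (hB0.trans hBβ)
      (fun t h1 h2 => hμ j hj t (by linarith) (by linarith)) (hN j hj)
    have mono := lastIndex_mono hτ' (a := τ j + h j) (b := τ (j + 1) - h (j + 1))
      (by linarith) (by linarith)
    rcases mono.eq_or_lt with e | lt
    · have := cell.1 e.symm
      simp only [hV, hp, ← e]
      exact ⟨by linarith, fun _ => trivial⟩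
    · obtain ⟨k, hk⟩ := Nat.exists_eq_add_of_lt lt
      have := cell.2 k hk
      have hV' : G ≤ V (τ (j + 1) - h (j + 1)) - V (τ j + h j) := by
        simp only [hV, hp, hk]
        push_cast
        linarith
      have : 0 ≤ (m + 1) * F + m * (F + 2 * D) := by positivity
      exact ⟨by linarith, fun hlt => absurd hlt (not_lt.2 hV')⟩
  -- windows
  have incW : ∀ j ∈ Finset.Icc 1 m, -(F + 2 * D) ≤ V (τ j + h j) - V (τ j - h j) - β ∧
      (V (τ j + h j) - V (τ j - h j) - β < G → p (τ j + h j) = p (τ j - h j) + 1) := by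
    intro j hj
    obtain ⟨h1, h2⟩ := Finset.mem_Icc.1 hj
    have hn := h_nonneg j
    have win := excess_window_ge hτ' (φ := φ) (μ := meanSignal m τ θ) (ν₁ := θ j)
      (ν₂ := θ (j + 1)) hn (hlo j hj).1 (hlo j hj).2 hF0 hA0 hD0 hB0 hAB
      (by
        obtain ⟨i, rfl⟩ : ∃ i, j = i + 1 := ⟨j - 1, by omega⟩
        have := h_sep i (by omega)
        have := h_nonneg i
        exact fun t h3 h4 => hμ i (by omega) t (by linarith) h4)
      (by
        have := h_sep j h2
        have := h_nonneg (j + 1)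
        exact fun t h3 h4 => hμ j h2 t h3 (by linarith))
      (hlA j hj) (hlD j hj) (hrA j hj) (hrD j hj)
    have mono := lastIndex_mono hτ' (hlo j hj).1 (by linarith : (τ j : ℝ) - h j ≤ τ j + h j)
    have hG0 : 0 ≤ (m + 1) * F + m * (F + 2 * D) := by positivity
    obtain ⟨k, hk⟩ := Nat.exists_eq_add_of_le mono
    rcases k with _ | _ | k
    · have w := win.1 hk
      have hJ := h_jump j hj
      have hV' : G ≤ V (τ j + h j) - V (τ j - h j) - β := by
        simp only [hV, hp, hk]
        push_cast
        linarith
      exact ⟨by linarith, fun hlt => absurd hlt (not_lt.2 hV')⟩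
    · have w := win.2.1 hk
      simp only [hV, hp, hk]
      push_cast
      exact ⟨by linarith, fun _ => by simp⟩
    · have w := win.2.2 k hk
      have hV' : G ≤ V (τ j + h j) - V (τ j - h j) - β := by
        have : (k : ℝ) * B ≤ k * β := mul_le_mul_of_nonneg_left hBβ (Nat.cast_nonneg _)
        simp only [hV, hp, hk]
        push_cast
        linarith
      exact ⟨by linarith, fun hlt => absurd hlt (not_lt.2 hV')⟩
  have hp0 : p 0 = 0 := by
    have h1 : (τ' (p 0) : ℝ) ≤ 0 := apply_lastIndex_le hτ' le_rfl
    have h2 : τ' (p 0) = 0 := by exact_mod_cast le_antisymm h1 (Nat.cast_nonneg _)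
    by_contra hne
    have h3 := hτ'.2.2 0 (Nat.zero_le _)
    have h4 := hτ'.apply_le_apply (i := 0 + 1) (j := p 0) (by omega)
      ((lastIndex_le _ _ _).trans (by omega))
    omega
  have hpT : p (T : ℝ) = m' := le_antisymm (lastIndex_le _ _ _)
    (le_lastIndex le_rfl (by exact_mod_cast hτ'.apply_le (by omega)))
  have hV0 : V (τ 0 + h 0) = 0 := by
    have : SI 0 = 0 := by
      have := stepIntegral_natCast T (excess (meanSignal m' τ' φ) (meanSignal m τ θ) z)
        (Nat.zero_le T)
      simpa using this
    simp [hV, hτ0, h_zero, hp0, this]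
  have hVT : V (τ (m + 1) - h (m + 1)) ≤ m * β := by
    simp only [hV, hτT, h_last, sub_zero, hpT, hSI]
    rw [stepIntegral_natCast T _ le_rfl]
    exact hmin
  -- the increments of `V` add up to `V T - V 0`
  have htel : ∀ n, ∑ j ∈ Finset.range (n + 1), (V (τ (j + 1) - h (j + 1)) - V (τ j + h j))
      + ∑ j ∈ Finset.range n, (V (τ (j + 1) + h (j + 1)) - V (τ (j + 1) - h (j + 1)) - β)
      = V (τ (n + 1) - h (n + 1)) - V (τ 0 + h 0) - n * β := by
    intro n
    induction n with
    | zero => simp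
    | succ n ih =>
      rw [Finset.sum_range_succ _ (n + 1), Finset.sum_range_succ
        (fun j => V (τ (j + 1) + h (j + 1)) - V (τ (j + 1) - h (j + 1)) - β) n]
      push_cast
      linarith
  have htot : ∑ j ∈ Finset.range (m + 1), (V (τ (j + 1) - h (j + 1)) - V (τ j + h j) + F)
      + ∑ j ∈ Finset.range m,
        (V (τ (j + 1) + h (j + 1)) - V (τ (j + 1) - h (j + 1)) - β + (F + 2 * D)) < G := by
    rw [Finset.sum_add_distrib, Finset.sum_add_distrib, Finset.sum_const, Finset.sum_const,
      Finset.card_range, Finset.card_range, nsmul_eq_mul, nsmul_eq_mul]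
    have := htel m
    push_cast
    linarith
  have nnN : ∀ j ∈ Finset.range (m + 1),
      0 ≤ V (τ (j + 1) - h (j + 1)) - V (τ j + h j) + F := fun j hj => by
    have := (incN j (Nat.lt_succ_iff.1 (Finset.mem_range.1 hj))).1
    linarith
  have nnW : ∀ j ∈ Finset.range m,
      0 ≤ V (τ (j + 1) + h (j + 1)) - V (τ (j + 1) - h (j + 1)) - β + (F + 2 * D) :=
    fun j hj => by
    have hj' := Finset.mem_range.1 hj
    have := (incW (j + 1) (Finset.mem_Icc.2 ⟨by omega, by omega⟩)).1
    linarith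
  have eqN : ∀ j ≤ m, p (τ (j + 1) - h (j + 1)) = p (τ j + h j) := by
    intro j hj
    refine (incN j hj).2 ?_
    have := Finset.single_le_sum nnN (Finset.mem_range.2 (Nat.lt_succ_iff.2 hj))
    have := Finset.sum_nonneg nnW
    linarith
  have eqW : ∀ j ∈ Finset.Icc 1 m, p (τ j + h j) = p (τ j - h j) + 1 := by
    intro j hj
    refine (incW j hj).2 ?_
    obtain ⟨h1, h2⟩ := Finset.mem_Icc.1 hj
    obtain ⟨i, rfl⟩ : ∃ i, j = i + 1 := ⟨j - 1, by omega⟩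
    have := Finset.single_le_sum nnW (Finset.mem_range.2 (by omega : i < m))
    have := Finset.sum_nonneg nnN
    linarith
  have hcount : ∀ j ≤ m, p (τ j + h j) = j := by
    intro j
    induction j with
    | zero => intro _; simp [hτ0, h_zero, hp0]
    | succ j ih =>
      intro hj
      rw [eqW (j + 1) (Finset.mem_Icc.2 ⟨by omega, hj⟩), eqN j (by omega), ih (by omega)]
  have hmm : m' = m := by
    have := eqN m le_rfl
    rw [hτT, h_last, sub_zero, hpT, hcount m le_rfl] at this
    exact this
  refine ⟨hmm, fun j hj => ?_⟩
  obtain ⟨h1, h2⟩ := Finset.mem_Icc.1 hj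
  obtain ⟨i, rfl⟩ : ∃ i, j = i + 1 := ⟨j - 1, by omega⟩
  have u1 : (τ' (p (τ (i + 1) + h (i + 1))) : ℝ) ≤ τ (i + 1) + h (i + 1) :=
    apply_lastIndex_le hτ' (by have := h_nonneg (i + 1); positivity)
  rw [hcount (i + 1) h2] at u1
  have u2 : (τ (i + 1) : ℝ) - h (i + 1) < τ' (i + 1) := by
    refine lt_apply_of_lastIndex_lt (m := m') (by omega) ?_
    have := eqN i (by omega)
    rw [hcount i (by omega)] at this
    exact this.trans_lt (Nat.lt_succ_self i)
  rw [abs_le]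
  constructor <;> linarith

/-! ### Minimisers of the penalised cost -/

theorem sum_segments {T m : ℕ} {τ : ℕ → ℕ} (hτ : IsSegmentation T m τ) (F : ℕ → ℝ) :
    ∑ j ∈ Finset.range (m + 1), ∑ t ∈ Finset.Ioc (τ j) (τ (j + 1)), F t
      = ∑ t ∈ Finset.Ioc 0 T, F t := by
  have : ∀ n ≤ m + 1, ∑ j ∈ Finset.range n, ∑ t ∈ Finset.Ioc (τ j) (τ (j + 1)), F t
      = ∑ t ∈ Finset.Ioc 0 (τ n), F t := by
    intro n
    induction n with
    | zero => intro _; simp [hτ.1]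
    | succ n ih =>
      intro hn
      rw [Finset.sum_range_succ, ih (by omega),
        Finset.sum_Ioc_consecutive _ (Nat.zero_le _) (hτ.2.2 n (by omega)).le]
  rw [this (m + 1) le_rfl, hτ.2.1]

theorem sum_segCost_eq {T m : ℕ} {τ : ℕ → ℕ} (hτ : IsSegmentation T m τ) (σ : ℝ) (x φ : ℕ → ℝ) :
    ∑ j ∈ Finset.range (m + 1), segCost σ x (τ j) (τ (j + 1)) (φ (j + 1))
      = ∑ t ∈ Finset.Ioc 0 T, (x t - meanSignal m τ φ t) ^ 2 / σ ^ 2 := by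
  rw [← sum_segments hτ]
  refine Finset.sum_congr rfl fun j hj => Finset.sum_congr rfl fun t ht => ?_
  obtain ⟨h1, h2⟩ := Finset.mem_Ioc.1 ht
  rw [meanSignal_eq hτ φ (Nat.lt_succ_iff.1 (Finset.mem_range.1 hj)) h1 h2]

theorem meanSignal_div (m : ℕ) (τ : ℕ → ℕ) (θ : ℕ → ℝ) (σ : ℝ) (t : ℕ) :
    meanSignal m τ (fun j => θ j / σ) t = meanSignal m τ θ t / σ := by
  simp only [meanSignal, Finset.sum_div]
  refine Finset.sum_congr rfl fun j _ => ?_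
  split_ifs <;> simp

/-- A minimiser of the penalised cost does at least as well as the true mean. -/
theorem IsPenalisedMinimiser.sum_excess_le {T m m' : ℕ} {τ τ' : ℕ → ℕ} {σ β : ℝ} (hσ : 0 < σ)
    {θ e : ℕ → ℝ} (hτ : IsSegmentation T m τ)
    (h : IsPenalisedMinimiser T σ β (fun t => meanSignal m τ θ t + e t) m' τ') :
    ∃ φ : ℕ → ℝ, ∑ t ∈ Finset.Ioc 0 T, excess (meanSignal m' τ' φ)
      (meanSignal m τ fun j => θ j / σ) (fun t => e t / σ) t + m' * β ≤ m * β := by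
  set x : ℕ → ℝ := fun t => meanSignal m τ θ t + e t with hx
  have h1 := h.2 m τ hτ
  unfold penalisedCost at h1
  have h2 : segmentationCost σ x m τ
      ≤ ∑ t ∈ Finset.Ioc 0 T, (x t - meanSignal m τ θ t) ^ 2 / σ ^ 2 := by
    rw [segmentationCost_eq T σ x m τ hτ, ← sum_segCost_eq hτ]
    exact Finset.sum_le_sum fun j hj =>
      segCost_segMean_le σ x (hτ.2.2 j (Nat.lt_succ_iff.1 (Finset.mem_range.1 hj))) _
  obtain ⟨φ, hφ⟩ : ∃ φ : ℕ → ℝ, segmentationCost σ x m' τ'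
      = ∑ t ∈ Finset.Ioc 0 T, (x t - meanSignal m' τ' φ t) ^ 2 / σ ^ 2 := by
    refine ⟨fun j => segMean x (τ' (j - 1)) (τ' j), ?_⟩
    rw [segmentationCost_eq T σ x m' τ' h.1, ← sum_segCost_eq h.1]
    rfl
  refine ⟨fun j => φ j / σ, ?_⟩
  have h3 : ∑ t ∈ Finset.Ioc 0 T, excess (meanSignal m' τ' fun j => φ j / σ)
      (meanSignal m τ fun j => θ j / σ) (fun t => e t / σ) t
      = ∑ t ∈ Finset.Ioc 0 T, (x t - meanSignal m' τ' φ t) ^ 2 / σ ^ 2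
        - ∑ t ∈ Finset.Ioc 0 T, (x t - meanSignal m τ θ t) ^ 2 / σ ^ 2 := by
    rw [← Finset.sum_sub_distrib]
    refine Finset.sum_congr rfl fun t _ => ?_
    rw [excess, meanSignal_div, meanSignal_div]
    simp only [hx]
    field_simp
    ring
  rw [hφ] at h1
  linarith

/-! ### Tail bounds for sums of independent sub-Gaussian variables -/

/-- Independence is preserved when a family is extended by the constant `0` to a larger index
set. -/
theorem iIndepFun_extend_zero {ι Ω : Type*} [DecidableEq ι] [MeasurableSpace Ω] {P : Measure Ω}
    [IsProbabilityMeasure P] {I : Finset ι} {e : ι → Ω → ℝ}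
    (h : iIndepFun (fun t : I => e t) P) :
    iIndepFun (fun t ω => if t ∈ I then e t ω else 0) P := by
  classical
  rw [iIndepFun_iff_measure_inter_preimage_eq_mul] at h ⊢
  intro S sets hS
  have hin : ∀ t ∈ I, (fun ω => if t ∈ I then e t ω else 0) ⁻¹' sets t = e t ⁻¹' sets t := by
    intro t ht; simp [ht]
  by_cases hex : ∃ t ∈ S, t ∉ I ∧ (0 : ℝ) ∉ sets t
  · obtain ⟨t, htS, htI, h0⟩ := hex
    have he : (fun ω => if t ∈ I then e t ω else 0) ⁻¹' sets t = ∅ := by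
      ext ω; simp [htI, h0]
    rw [Finset.prod_eq_zero htS (by rw [he, measure_empty])]
    refine measure_mono_null (Set.biInter_subset_of_mem htS) ?_
    rw [he, measure_empty]
  · push Not at hex
    have hout : ∀ t ∈ S, t ∉ I → (fun ω => if t ∈ I then e t ω else 0) ⁻¹' sets t = Set.univ := by
      intro t htS htI; ext ω; simp [htI, hex t htS htI]
    have key := h (S.subtype (· ∈ I)) (sets := fun t => sets t)
      (fun t ht => hS t (Finset.mem_subtype.1 ht))
    rw [Finset.prod_subtype_eq_prod_filter (f := fun t => P (e t ⁻¹' sets t)),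
      Finset.prod_filter] at key
    have h1 : (⋂ t ∈ S, (fun ω => if t ∈ I then e t ω else 0) ⁻¹' sets t)
        = ⋂ t ∈ S.subtype (· ∈ I), e t ⁻¹' sets t := by
      ext ω
      simp only [Set.mem_iInter, Finset.mem_subtype, Subtype.forall]
      constructor
      · intro H t ht htS
        rw [← hin t ht]; exact H t htS
      · intro H t htS
        by_cases ht : t ∈ I
        · rw [hin t ht]; exact H t ht htS
        · rw [hout t htS ht]; trivial
    rw [h1, key]
    refine Finset.prod_congr rfl fun t htS => ?_
    by_cases ht : t ∈ I
    · rw [if_pos ht, hin t ht]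
    · rw [if_neg ht, hout t htS ht, measure_univ]

/-- A sequence of independent variables that satisfy the moment generating function bounds of a
centred Gaussian with variance at most `1`. The lower bound holds for all centred variables. -/
structure IsNoise {Ω : Type*} [MeasurableSpace Ω] (P : Measure Ω) (Z : ℕ → Ω → ℝ) : Prop where
  measurable : ∀ t, Measurable (Z t)
  indep : iIndepFun Z P
  subgaussian : ∀ t, HasSubgaussianMGF (Z t) 1 P
  one_le_mgf : ∀ t l, 1 ≤ mgf (Z t) P l

section

variable {Ω : Type*} [MeasurableSpace Ω] {P : Measure Ω} {Z : ℕ → Ω → ℝ}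

theorem IsNoise.neg (h : IsNoise P Z) : IsNoise P (fun t ω => -Z t ω) where
  measurable t := (h.measurable t).neg
  indep := h.indep.comp (fun _ x => -x) fun _ => measurable_neg
  subgaussian t := (h.subgaussian t).neg
  one_le_mgf t l := by
    have := h.one_le_mgf t (-l)
    simpa [mgf] using this

theorem IsNoise.precomp (h : IsNoise P Z) {g : ℕ → ℕ} (hg : g.Injective) :
    IsNoise P (fun t => Z (g t)) where
  measurable _ := h.measurable _
  indep := h.indep.precomp hg
  subgaussian _ := h.subgaussian _
  one_le_mgf _ := h.one_le_mgf _

theorem IsNoise.isProbabilityMeasure (h : IsNoise P Z) : IsProbabilityMeasure P :=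
  h.indep.isProbabilityMeasure

/-- Tail bound for a weighted sum with weights in `[0, 1]`, normalised by the sum of the weights
(which is at least the variance). -/
theorem IsNoise.measureReal_lt_sq_weighted_sum_le (h : IsNoise P Z) {s : Finset ℕ} {w : ℕ → ℝ}
    (hw0 : ∀ t ∈ s, 0 ≤ w t) (hw1 : ∀ t ∈ s, w t ≤ 1) {y : ℝ} (hy : 0 ≤ y) :
    P.real {ω | y * ∑ t ∈ s, w t < (∑ t ∈ s, w t * Z t ω) ^ 2} ≤ 2 * Real.exp (-y / 2) := by
  have := h.isProbabilityMeasure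
  set W := ∑ t ∈ s, w t with hW
  have hW0 : 0 ≤ W := Finset.sum_nonneg hw0
  rcases hW0.eq_or_lt with h0 | hpos
  · have hz : ∀ t ∈ s, w t = 0 := (Finset.sum_eq_zero_iff_of_nonneg hw0).1 h0.symm
    have : {ω | y * W < (∑ t ∈ s, w t * Z t ω) ^ 2} = ∅ := by
      ext ω
      have : ∑ t ∈ s, w t * Z t ω = 0 :=
        Finset.sum_eq_zero fun t ht => by rw [hz t ht, zero_mul]
      simp [this, ← h0]
    rw [this, measureReal_empty]
    positivity
  set c : NNReal := ∑ t ∈ s, (⟨(w t) ^ 2, sq_nonneg _⟩ * 1 : NNReal) with hc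
  have hcv : (c : ℝ) = ∑ t ∈ s, (w t) ^ 2 := by
    rw [hc, NNReal.coe_sum]
    exact Finset.sum_congr rfl fun t _ => mul_one ((w t) ^ 2)
  have hcW : (c : ℝ) ≤ W := by
    rw [hcv]
    exact Finset.sum_le_sum fun t ht => by nlinarith [hw0 t ht, hw1 t ht]
  have hcpos : (0 : ℝ) < c := by
    rw [hcv]
    obtain ⟨t, ht, htp⟩ := Finset.exists_lt_of_sum_lt (f := fun _ => (0 : ℝ)) (g := w) (s := s)
      (by simpa using hpos)
    exact Finset.sum_pos' (fun t _ => sq_nonneg _) ⟨t, ht, by positivity⟩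
  have hindep : iIndepFun (fun t ω => w t * Z t ω) P :=
    h.indep.comp (fun t x => w t * x) fun t => measurable_const_mul _
  have hsub : HasSubgaussianMGF (fun ω => ∑ t ∈ s, w t * Z t ω) c P :=
    HasSubgaussianMGF.sum_of_iIndepFun hindep fun t _ => (h.subgaussian t).const_mul (w t)
  have hexp : Real.exp (-Real.sqrt (y * W) ^ 2 / (2 * c)) ≤ Real.exp (-y / 2) := by
    rw [Real.sq_sqrt (by positivity)]
    apply Real.exp_le_exp.2
    rw [neg_div, neg_div, neg_le_neg_iff, div_le_div_iff₀ (by norm_num) (by positivity)]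
    nlinarith [mul_le_mul_of_nonneg_left hcW hy]
  have t1 := (hsub.measure_ge_le (Real.sqrt_nonneg (y * W))).trans hexp
  have t2 := (hsub.neg.measure_ge_le (Real.sqrt_nonneg (y * W))).trans hexp
  calc P.real {ω | y * W < (∑ t ∈ s, w t * Z t ω) ^ 2}
      ≤ P.real ({ω | Real.sqrt (y * W) ≤ ∑ t ∈ s, w t * Z t ω}
          ∪ {ω | Real.sqrt (y * W) ≤ (-fun ω => ∑ t ∈ s, w t * Z t ω) ω}) := by
        refine measureReal_mono fun ω hω => ?_
        have := (Real.sqrt_lt_sqrt (by positivity) hω).le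
        rw [Real.sqrt_sq_eq_abs] at this
        exact (le_abs.1 this)
    _ ≤ _ := (measureReal_union_le _ _).trans (by linarith)

theorem IsNoise.lintegral_exp_eq (h : IsNoise P Z) (l : ℝ) (t : ℕ) :
    ∫⁻ ω, ENNReal.ofReal (Real.exp (l * Z t ω)) ∂P = ENNReal.ofReal (mgf (Z t) P l) := by
  rw [mgf, ofReal_integral_eq_lintegral_ofReal ((h.subgaussian t).integrable_exp_mul l)]
  exact Filter.Eventually.of_forall fun ω => (Real.exp_pos _).le

theorem measurableSet_exists_le_sum {α : Type*} [MeasurableSpace α] {X : ℕ → α → ℝ}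
    (hX : ∀ i, Measurable (X i)) (x : ℝ) (N : ℕ) :
    MeasurableSet {a | ∃ k ≤ N, x ≤ ∑ i ∈ Finset.range k, X i a} := by
  have : {a | ∃ k ≤ N, x ≤ ∑ i ∈ Finset.range k, X i a}
      = ⋃ k ∈ Finset.range (N + 1), {a | x ≤ ∑ i ∈ Finset.range k, X i a} := by
    ext a; simp
  rw [this]
  exact Finset.measurableSet_biUnion _ fun k _ =>
    measurableSet_le measurable_const (Finset.measurable_sum _ fun i _ => hX i)

theorem IsNoise.indepFun_initial (h : IsNoise P Z) (N : ℕ) {Φ : (ℕ → ℝ) → ENNReal}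
    (hΦ : Measurable Φ) : IndepFun (fun ω => Φ fun i => if i < N then Z i ω else 0) (Z N) P := by
  have hind := h.indep.indepFun_finset (Finset.range N) {N} (by simp) h.measurable
  have hφ : Measurable fun (v : Finset.range N → ℝ) (i : ℕ) =>
      if hi : i < N then v ⟨i, Finset.mem_range.2 hi⟩ else 0 := by
    refine measurable_pi_lambda _ fun i => ?_
    by_cases hi : i < N
    · simpa [hi] using measurable_pi_apply _
    · simp [hi]
  exact hind.comp (hΦ.comp hφ)
    (measurable_pi_apply (⟨N, Finset.mem_singleton_self N⟩ : ({N} : Finset ℕ)))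

/-- Doob's maximal inequality for the exponential submartingale of the partial sums. In the
induction step, the event that the level has been reached within the first `N` steps is independent
of the next increment. -/
theorem IsNoise.exp_mul_measure_exists_le (h : IsNoise P Z) {l : ℝ} (hl : 0 ≤ l) (x : ℝ) (N : ℕ) :
    ENNReal.ofReal (Real.exp (l * x)) * P {ω | ∃ k ≤ N, x ≤ ∑ i ∈ Finset.range k, Z i ω} ≤
      ∫⁻ ω, {ω | ∃ k ≤ N, x ≤ ∑ i ∈ Finset.range k, Z i ω}.indicator
        (fun ω => ENNReal.ofReal (Real.exp (l * ∑ i ∈ Finset.range N, Z i ω))) ω ∂P := by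
  have hSm : ∀ n, Measurable fun ω => ∑ i ∈ Finset.range n, Z i ω := fun n =>
    Finset.measurable_sum _ fun i _ => h.measurable i
  have hC := measurableSet_exists_le_sum h.measurable x
  have hreach : ∀ (N : ℕ) (D : Set Ω), MeasurableSet D →
      (∀ ω ∈ D, x ≤ ∑ i ∈ Finset.range N, Z i ω) → ENNReal.ofReal (Real.exp (l * x)) * P D ≤
        ∫⁻ ω, D.indicator
          (fun ω => ENNReal.ofReal (Real.exp (l * ∑ i ∈ Finset.range N, Z i ω))) ω ∂P := by
    intro N D hD hx
    rw [← lintegral_indicator_const hD]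
    refine lintegral_mono fun ω => Set.indicator_le_indicator' fun hω => ?_
    exact ENNReal.ofReal_le_ofReal (Real.exp_le_exp.2 (mul_le_mul_of_nonneg_left (hx ω hω) hl))
  induction N with
  | zero =>
    refine hreach 0 _ (hC 0) ?_
    rintro ω ⟨k, hk, hx⟩
    obtain rfl := Nat.le_zero.1 hk
    exact hx
  | succ N ih =>
    set C := {ω | ∃ k ≤ N, x ≤ ∑ i ∈ Finset.range k, Z i ω} with hCdef
    set D := {ω | x ≤ ∑ i ∈ Finset.range (N + 1), Z i ω} \ C with hDdef
    have hD : MeasurableSet D := (measurableSet_le measurable_const (hSm _)).diff (hC N)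
    have hCD : Disjoint C D := Set.disjoint_sdiff_right
    have hU : {ω | ∃ k ≤ N + 1, x ≤ ∑ i ∈ Finset.range k, Z i ω} = C ∪ D := by
      rw [hDdef, Set.union_sdiff_self]
      ext ω
      constructor
      · rintro ⟨k, hk, hx⟩
        rcases Nat.le_succ_iff.1 hk with hk | rfl
        · exact Or.inl ⟨k, hk, hx⟩
        · exact Or.inr hx
      · rintro (⟨k, hk, hx⟩ | hx)
        · exact ⟨k, by omega, hx⟩
        · exact ⟨N + 1, le_rfl, hx⟩
    have hstep : ∫⁻ ω, C.indicator
          (fun ω => ENNReal.ofReal (Real.exp (l * ∑ i ∈ Finset.range N, Z i ω))) ω ∂P ≤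
        ∫⁻ ω, C.indicator
          (fun ω => ENNReal.ofReal (Real.exp (l * ∑ i ∈ Finset.range (N + 1), Z i ω))) ω ∂P := by
      have hfun : ∀ ω, C.indicator
          (fun ω => ENNReal.ofReal (Real.exp (l * ∑ i ∈ Finset.range N, Z i ω))) ω
          = {v : ℕ → ℝ | ∃ k ≤ N, x ≤ ∑ i ∈ Finset.range k, v i}.indicator
            (fun v => ENNReal.ofReal (Real.exp (l * ∑ i ∈ Finset.range N, v i)))
            (fun i => if i < N then Z i ω else 0) := by
        intro ω
        have hk : ∀ k ≤ N, ∑ i ∈ Finset.range k, (if i < N then Z i ω else 0)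
            = ∑ i ∈ Finset.range k, Z i ω := fun k hk =>
          Finset.sum_congr rfl fun i hi => if_pos ((Finset.mem_range.1 hi).trans_le hk)
        have hmem : (fun i => if i < N then Z i ω else 0) ∈
            {v : ℕ → ℝ | ∃ k ≤ N, x ≤ ∑ i ∈ Finset.range k, v i} ↔ ω ∈ C :=
          exists_congr fun k => and_congr_right fun hkN => by rw [hk k hkN]
        by_cases hω : ω ∈ C
        · rw [Set.indicator_of_mem hω, Set.indicator_of_mem (hmem.2 hω), hk N le_rfl]
        · rw [Set.indicator_of_notMem hω, Set.indicator_of_notMem (fun h => hω (hmem.1 h))]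
      have hind := h.indepFun_initial N (Φ := {v : ℕ → ℝ | ∃ k ≤ N, x ≤
          ∑ i ∈ Finset.range k, v i}.indicator
          (fun v => ENNReal.ofReal (Real.exp (l * ∑ i ∈ Finset.range N, v i))))
        (Measurable.indicator (by fun_prop)
          (measurableSet_exists_le_sum (fun i => measurable_pi_apply i) x N))
      have hprod := lintegral_mul_eq_lintegral_mul_lintegral_of_indepFun
        (f := C.indicator
          (fun ω => ENNReal.ofReal (Real.exp (l * ∑ i ∈ Finset.range N, Z i ω))))
        (g := fun ω => ENNReal.ofReal (Real.exp (l * Z N ω)))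
        (Measurable.indicator (Real.measurable_exp.comp ((hSm N).const_mul l)).ennreal_ofReal
          (measurableSet_exists_le_sum h.measurable x N))
        (Real.measurable_exp.comp ((h.measurable N).const_mul l)).ennreal_ofReal
        (by
          rw [funext hfun]
          exact hind.comp measurable_id
            (Real.measurable_exp.comp (measurable_id.const_mul l)).ennreal_ofReal)
      rw [h.lintegral_exp_eq] at hprod
      have heq : ∀ ω, C.indicator
          (fun ω => ENNReal.ofReal (Real.exp (l * ∑ i ∈ Finset.range (N + 1), Z i ω))) ω
          = C.indicator (fun ω => ENNReal.ofReal (Real.exp (l * ∑ i ∈ Finset.range N, Z i ω))) ω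
            * ENNReal.ofReal (Real.exp (l * Z N ω)) := by
        intro ω
        by_cases hω : ω ∈ C
        · rw [Set.indicator_of_mem hω, Set.indicator_of_mem hω,
            ← ENNReal.ofReal_mul (Real.exp_pos _).le, ← Real.exp_add, Finset.sum_range_succ,
            mul_add]
        · rw [Set.indicator_of_notMem hω, Set.indicator_of_notMem hω, zero_mul]
      rw [lintegral_congr heq]
      refine le_trans ?_ (le_of_eq hprod.symm)
      calc _ = _ * (1 : ENNReal) := (mul_one _).symm
        _ ≤ _ := by
          gcongr
          rw [← ENNReal.ofReal_one]
          exact ENNReal.ofReal_le_ofReal (h.one_le_mgf N l)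
    rw [hU, Set.indicator_union_of_disjoint hCD, measure_union hCD hD, mul_add]
    have hm : Measurable fun ω => C.indicator
        (fun ω => ENNReal.ofReal (Real.exp (l * ∑ i ∈ Finset.range (N + 1), Z i ω))) ω :=
      Measurable.indicator (Real.measurable_exp.comp ((hSm _).const_mul l)).ennreal_ofReal (hC N)
    rw [lintegral_add_left hm]
    exact add_le_add (ih.trans hstep) (hreach (N + 1) D hD fun ω hω => hω.1)

theorem IsNoise.measureReal_exists_le (h : IsNoise P Z) {x v : ℝ} (hx : 0 ≤ x) (hv : 0 < v)
    {N : ℕ} (hN : (N : ℝ) ≤ v) :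
    P.real {ω | ∃ k ≤ N, x ≤ ∑ i ∈ Finset.range k, Z i ω} ≤ Real.exp (-x ^ 2 / (2 * v)) := by
  have := h.isProbabilityMeasure
  set C := {ω | ∃ k ≤ N, x ≤ ∑ i ∈ Finset.range k, Z i ω} with hC
  set l := x / v with hl
  have hl0 : 0 ≤ l := by positivity
  have h1 := h.exp_mul_measure_exists_le hl0 x N
  have hsub : HasSubgaussianMGF (fun ω => ∑ i ∈ Finset.range N, Z i ω)
      (∑ i ∈ Finset.range N, 1) P :=
    HasSubgaussianMGF.sum_of_iIndepFun h.indep fun t _ => h.subgaussian t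
  have h2 : ∫⁻ ω, C.indicator
      (fun ω => ENNReal.ofReal (Real.exp (l * ∑ i ∈ Finset.range N, Z i ω))) ω ∂P
      ≤ ENNReal.ofReal (Real.exp (v * l ^ 2 / 2)) := by
    calc _ ≤ ∫⁻ ω, ENNReal.ofReal (Real.exp (l * ∑ i ∈ Finset.range N, Z i ω)) ∂P :=
          lintegral_mono fun ω => Set.indicator_le_self' (fun _ _ => bot_le) ω
      _ = ENNReal.ofReal (mgf (fun ω => ∑ i ∈ Finset.range N, Z i ω) P l) := by
          rw [mgf, ofReal_integral_eq_lintegral_ofReal (hsub.integrable_exp_mul l)]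
          exact Filter.Eventually.of_forall fun ω => (Real.exp_pos _).le
      _ ≤ _ := by
          refine ENNReal.ofReal_le_ofReal ((hsub.mgf_le l).trans (Real.exp_le_exp.2 ?_))
          simp only [Finset.sum_const, Finset.card_range, nsmul_eq_mul, mul_one, NNReal.coe_natCast]
          gcongr
  have h3 : Real.exp (l * x) * P.real C ≤ Real.exp (v * l ^ 2 / 2) := by
    have := ENNReal.toReal_mono ENNReal.ofReal_ne_top (h1.trans h2)
    rwa [ENNReal.toReal_mul, ENNReal.toReal_ofReal (Real.exp_pos _).le,
      ENNReal.toReal_ofReal (Real.exp_pos _).le] at this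
  rw [mul_comm, ← le_div_iff₀ (Real.exp_pos _), ← Real.exp_sub] at h3
  refine h3.trans (Real.exp_le_exp.2 (le_of_eq ?_))
  rw [hl]
  field_simp
  ring

/-- Bound for the probability that some partial sum of length `k ≤ T` has square above `y * k`. The
lengths are divided into the `K` ranges `[r ^ i, r ^ (i + 1))`, with the maximal inequality applied
on each, at the cost of a factor `r` in the exponent. -/
theorem IsNoise.measureReal_exists_lt_sq_le (h : IsNoise P Z) {y r : ℝ} (hy : 0 ≤ y) (hr : 1 < r)
    {T K : ℕ} (hK : (T : ℝ) < r ^ K) :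
    P.real {ω | ∃ k ≤ T, y * k < (∑ i ∈ Finset.range k, Z i ω) ^ 2} ≤
      2 * K * Real.exp (-y / (2 * r)) := by
  have := h.isProbabilityMeasure
  have hr0 : 0 < r := by linarith
  let N : ℕ → ℕ := fun i => ⌊r ^ (i + 1)⌋₊
  let U : ℕ → Set Ω := fun i =>
    {ω | ∃ k ≤ N i, Real.sqrt (y * r ^ i) ≤ ∑ j ∈ Finset.range k, Z j ω}
      ∪ {ω | ∃ k ≤ N i, Real.sqrt (y * r ^ i) ≤ ∑ j ∈ Finset.range k, -Z j ω}
  have hU : ∀ i, P.real (U i) ≤ 2 * Real.exp (-y / (2 * r)) := by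
    intro i
    have hN : ((N i : ℕ) : ℝ) ≤ r ^ (i + 1) := Nat.floor_le (by positivity)
    have e : -Real.sqrt (y * r ^ i) ^ 2 / (2 * r ^ (i + 1)) = -y / (2 * r) := by
      rw [Real.sq_sqrt (by positivity), pow_succ]
      field_simp
    have h1 := h.measureReal_exists_le (Real.sqrt_nonneg (y * r ^ i)) (by positivity) hN
    have h2 := h.neg.measureReal_exists_le (Real.sqrt_nonneg (y * r ^ i)) (by positivity) hN
    rw [e] at h1 h2
    exact (measureReal_union_le _ _).trans (by linarith)
  calc P.real {ω | ∃ k ≤ T, y * k < (∑ i ∈ Finset.range k, Z i ω) ^ 2}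
      ≤ P.real (⋃ i ∈ Finset.range K, U i) := by
        refine measureReal_mono (fun ω => ?_) (measure_ne_top _ _)
        rintro ⟨k, hkT, hk⟩
        have hk1 : 1 ≤ k := by
          rcases k.eq_zero_or_pos with rfl | hpos
          · simp at hk
          · exact hpos
        obtain ⟨i, hi1, hi2⟩ := exists_nat_pow_near (by exact_mod_cast hk1 : (1 : ℝ) ≤ k) hr
        have hiK : i < K := by
          refine (pow_lt_pow_iff_right₀ hr).1 (hi1.trans_lt (lt_of_le_of_lt ?_ hK))
          exact_mod_cast hkT
        refine Set.mem_biUnion (Finset.mem_coe.2 (Finset.mem_range.2 hiK)) ?_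
        have hkN : k ≤ N i := Nat.le_floor hi2.le
        have hle : y * r ^ i ≤ (∑ j ∈ Finset.range k, Z j ω) ^ 2 :=
          (mul_le_mul_of_nonneg_left hi1 hy).trans hk.le
        have := Real.sqrt_le_sqrt hle
        rw [Real.sqrt_sq_eq_abs] at this
        rcases le_abs.1 this with h1 | h1
        · exact Or.inl ⟨k, hkN, h1⟩
        · exact Or.inr ⟨k, hkN, by rwa [Finset.sum_neg_distrib]⟩
    _ ≤ ∑ i ∈ Finset.range K, P.real (U i) := measureReal_biUnion_finset_le _ _
    _ ≤ ∑ i ∈ Finset.range K, 2 * Real.exp (-y / (2 * r)) := Finset.sum_le_sum fun i _ => hU i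
    _ = _ := by rw [Finset.sum_const, Finset.card_range, nsmul_eq_mul]; ring

end

/-! ### The noise on the cells -/

/-- The event that the squared noise sum over the interval between `a` and `b` exceeds `y` times the
length of the interval. -/
def exceedance {Ω : Type*} (T : ℕ) (Z : ℕ → Ω → ℝ) (y a b : ℝ) : Set Ω :=
  {ω | y * |b - a| <
    (stepIntegral T (fun t => Z t ω) b - stepIntegral T (fun t => Z t ω) a) ^ 2}

/-- The event that the exceedance occurs for some interval in `[0, T]` with integer endpoints one of
which is `s`. -/
def anchoredExceedance {Ω : Type*} (T : ℕ) (Z : ℕ → Ω → ℝ) (y : ℝ) (s : ℕ) : Set Ω :=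
  {ω | s ≤ T ∧ ∃ u ≤ T, ω ∈ exceedance T Z y s u}

theorem le_of_notMem_exceedance {Ω : Type*} {T : ℕ} {Z : ℕ → Ω → ℝ} {y a b : ℝ} {ω : Ω}
    (h : ω ∉ exceedance T Z y a b) :
    (stepIntegral T (fun t => Z t ω) b - stepIntegral T (fun t => Z t ω) a) ^ 2
      ≤ y * |b - a| := not_lt.1 h

theorem exceedance_comm {Ω : Type*} (T : ℕ) (Z : ℕ → Ω → ℝ) (y a b : ℝ) :
    exceedance T Z y a b = exceedance T Z y b a := by
  ext ω
  simp only [exceedance, Set.mem_ofPred_eq]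
  rw [abs_sub_comm, ← neg_sq, neg_sub]

/-- Union of the events for the two integers around the real number `x`. -/
def realAnchoredExceedance {Ω : Type*} (T : ℕ) (Z : ℕ → Ω → ℝ) (y x : ℝ) : Set Ω :=
  anchoredExceedance T Z y ⌊x⌋₊ ∪ anchoredExceedance T Z y (⌊x⌋₊ + 1)

theorem le_of_notMem_realAnchoredExceedance {Ω : Type*} {Z : ℕ → Ω → ℝ} {T : ℕ} {y x : ℝ} {ω : Ω}
    (hx : 0 ≤ x)
    (h : ω ∉ realAnchoredExceedance T Z y x) {u : ℕ} (hu : u ≤ T) :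
    (x ≤ u → (stepIntegral T (fun t => Z t ω) u - stepIntegral T (fun t => Z t ω) x) ^ 2
      ≤ y * (u - x)) ∧
    (u ≤ x → x ≤ T → (stepIntegral T (fun t => Z t ω) x - stepIntegral T (fun t => Z t ω) u) ^ 2
      ≤ y * (x - u)) := by
  refine sq_stepIntegral_sub_le_of_nat hx fun n hn => ?_
  have hn' : ω ∉ anchoredExceedance T Z y n := by
    rcases hn with rfl | rfl
    · exact fun h' => h (Or.inl h')
    · exact fun h' => h (Or.inr h')
  have key : n ≤ T → ω ∉ exceedance T Z y n u := fun hnT h' => hn' ⟨hnT, u, hu, h'⟩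
  constructor
  · intro hnu
    have := le_of_notMem_exceedance (key (hnu.trans hu))
    rwa [abs_of_nonneg (sub_nonneg.2 (by exact_mod_cast hnu))] at this
  · intro hun hnT
    have := key hnT
    rw [exceedance_comm] at this
    have := le_of_notMem_exceedance this
    rwa [abs_of_nonneg (sub_nonneg.2 (by exact_mod_cast hun))] at this

section

variable {Ω : Type*} [MeasurableSpace Ω] {P : Measure Ω} {Z : ℕ → Ω → ℝ}

theorem IsNoise.measureReal_exceedance_le (h : IsNoise P Z) {T : ℕ} {y a b : ℝ} (hy : 0 ≤ y)
    (ha : 0 ≤ a) (haT : a ≤ T) (hb : 0 ≤ b) (hbT : b ≤ T) :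
    P.real (exceedance T Z y a b) ≤ 2 * Real.exp (-y / 2) := by
  wlog hab : a ≤ b generalizing a b
  · rw [exceedance_comm]
    exact this hb hbT ha haT (not_le.1 hab).le
  have := h.measureReal_lt_sq_weighted_sum_le (s := Finset.Icc 1 T)
    (w := fun t => clip b t - clip a t) (fun t _ => sub_nonneg.2 (clip_mono hab t))
    (fun t _ => by linarith [clip_le_one b t, clip_nonneg a t]) hy
  convert this using 2
  ext ω
  simp only [exceedance, Set.mem_ofPred_eq, stepIntegral, sub_mul, Finset.sum_sub_distrib]
  rw [sum_clip_eq_min ha, sum_clip_eq_min hb, min_eq_left haT, min_eq_left hbT,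
    abs_of_nonneg (sub_nonneg.2 hab)]

theorem stepIntegral_add_sub (T : ℕ) (f : ℕ → ℝ) {s k : ℕ} (h : s + k ≤ T) :
    stepIntegral T f (s + k : ℕ) - stepIntegral T f s = ∑ i ∈ Finset.range k, f (s + i + 1) := by
  rw [stepIntegral_natCast T f h, stepIntegral_natCast T f (by omega : s ≤ T)]
  clear h
  induction k with
  | zero => simp
  | succ k ih =>
    rw [Finset.sum_range_succ, ← ih, ← add_assoc, Finset.sum_Ioc_succ_top (Nat.zero_le _)]
    ring

theorem stepIntegral_sub_sub (T : ℕ) (f : ℕ → ℝ) {s k : ℕ} (hs : s ≤ T) (h : k ≤ s) :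
    stepIntegral T f s - stepIntegral T f (s - k : ℕ) = ∑ i ∈ Finset.range k, f (s - i) := by
  rw [stepIntegral_natCast T f hs, stepIntegral_natCast T f (by omega : s - k ≤ T)]
  clear hs
  induction k with
  | zero => simp
  | succ k ih =>
    rw [Finset.sum_range_succ, ← ih (by omega), show s - k = s - (k + 1) + 1 by omega,
      Finset.sum_Ioc_succ_top (Nat.zero_le _)]
    ring

/-- The maximal inequality is applied to the partial sums that run forwards and backwards from
`s`. -/
theorem IsNoise.measureReal_anchoredExceedance_le (h : IsNoise P Z) {T K s : ℕ} {y r : ℝ}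
    (hy : 0 ≤ y) (hr : 1 < r) (hK : (T : ℝ) < r ^ K) :
    P.real (anchoredExceedance T Z y s) ≤ 4 * K * Real.exp (-y / (2 * r)) := by
  have := h.isProbabilityMeasure
  let g : ℕ → ℕ := fun i => if i ≤ s then s - i else i
  have hg : g.Injective := by
    intro i j hij
    simp only [g] at hij
    split_ifs at hij <;> omega
  have h1 := (h.precomp (g := fun i => s + i + 1) fun i j hij => by simpa using hij
    ).measureReal_exists_lt_sq_le hy hr hK
  have h2 := (h.precomp hg).measureReal_exists_lt_sq_le hy hr hK
  refine (measureReal_mono ?_ (measure_ne_top _ _)).trans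
    ((measureReal_union_le _ _).trans ((add_le_add h1 h2).trans (le_of_eq (by ring))))
  rintro ω ⟨hs, u, hu, hω⟩
  rcases le_total s u with hsu | hus
  · obtain ⟨k, rfl⟩ := Nat.exists_eq_add_of_le hsu
    refine Or.inl ⟨k, by omega, ?_⟩
    simp only [exceedance, Set.mem_ofPred_eq] at hω
    rw [stepIntegral_add_sub T _ hu] at hω
    push_cast at hω
    rwa [add_sub_cancel_left, abs_of_nonneg (Nat.cast_nonneg k)] at hω
  · obtain ⟨k, rfl⟩ := Nat.exists_eq_add_of_le hus
    refine Or.inr ⟨k, by omega, ?_⟩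
    rw [exceedance_comm] at hω
    simp only [exceedance, Set.mem_ofPred_eq] at hω
    have e := stepIntegral_sub_sub T (fun t => Z t ω) hs (by omega : k ≤ u + k)
    rw [Nat.add_sub_cancel] at e
    rw [e] at hω
    push_cast at hω
    rw [add_sub_cancel_left, abs_of_nonneg (Nat.cast_nonneg k)] at hω
    have : ∑ i ∈ Finset.range k, Z (g i) ω = ∑ i ∈ Finset.range k, Z (u + k - i) ω :=
      Finset.sum_congr rfl fun i hi => by
        have := Finset.mem_range.1 hi
        simp only [g]
        rw [if_pos (by omega)]
    rw [this]
    exact hω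

theorem measureReal_biUnion_le_card_mul {ι : Type*} (s : Finset ι) {f : ι → Set Ω} {c : ℝ}
    (h : ∀ i ∈ s, P.real (f i) ≤ c) : P.real (⋃ i ∈ s, f i) ≤ s.card * c :=
  (measureReal_biUnion_finset_le _ _).trans
    ((Finset.sum_le_sum h).trans (by rw [Finset.sum_const, nsmul_eq_mul]))

/-- Outside an event of small probability, the noise bounds needed for the recovery of the
changepoints hold on all cells. The whole cells are treated one by one with level `F`. Near the
changepoints, the intervals with an integer endpoint are covered by union bounds, with level `D`
when they share their other endpoint with the cell and with level `B` otherwise. The maximal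
inequality gives the levels `A` and `β`. -/
theorem IsNoise.exists_event_cellNoise (hZ : IsNoise P Z) {T m K : ℕ} {τ : ℕ → ℕ} {h : ℕ → ℝ}
    {F A D B β H r : ℝ} (hτ : IsSegmentation T m τ)
    (h_nonneg : ∀ j, 0 ≤ h j) (h_le : ∀ j, h j ≤ H)
    (h_sep : ∀ j ≤ m, h j + h (j + 1) ≤ (τ (j + 1) : ℝ) - τ j)
    (hF0 : 0 ≤ F) (hA0 : 0 ≤ A) (hFD : F ≤ D) (hB0 : 0 ≤ B) (hβ0 : 0 ≤ β) (hr : 1 < r)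
    (hK : (T : ℝ) < r ^ K) :
    ∃ E : Set Ω,
      P.real E ≤ (3 * m + 1) * (2 * Real.exp (-F / 2)) + m * (H * (8 * Real.exp (-D / 2)))
        + m * ((H + 1) ^ 2 * (4 * Real.exp (-B / 2)))
        + (3 * m + 2) * (8 * K * Real.exp (-A / (2 * r)))
        + (T + 1) * (4 * K * Real.exp (-β / (2 * r))) ∧
      ∀ ω ∉ E,
        (∀ j ≤ m, CellNoise T (fun t => Z t ω) (τ j + h j) (τ (j + 1) - h (j + 1)) F A β) ∧
        (∀ j ∈ Finset.Icc 1 m, CellNoise T (fun t => Z t ω) (τ j - h j) (τ j) F A B) ∧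
        (∀ j ∈ Finset.Icc 1 m, CellNoise T (fun t => Z t ω) (τ j - h j) (τ j) F D B) ∧
        (∀ j ∈ Finset.Icc 1 m, CellNoise T (fun t => Z t ω) (τ j) (τ j + h j) F A B) ∧
        (∀ j ∈ Finset.Icc 1 m, CellNoise T (fun t => Z t ω) (τ j) (τ j + h j) F D B) := by
  have := hZ.isProbabilityMeasure
  have hD0 : 0 ≤ D := hF0.trans hFD
  have hH0 : 0 ≤ H := (h_nonneg 0).trans (h_le 0)
  have hτT : ∀ j ≤ m + 1, (τ j : ℝ) ≤ T := fun j hj => by exact_mod_cast hτ.apply_le hj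
  have hτ0 : ∀ j, (0 : ℝ) ≤ τ j := fun j => Nat.cast_nonneg _
  have hlo : ∀ j ∈ Finset.Icc 1 m, (0 : ℝ) ≤ τ j - h j ∧ (τ j : ℝ) + h j ≤ T := by
    intro j hj
    obtain ⟨h1, h2⟩ := Finset.mem_Icc.1 hj
    obtain ⟨i, rfl⟩ : ∃ i, j = i + 1 := ⟨j - 1, by omega⟩
    have s1 := h_sep i (by omega)
    have s2 := h_sep (i + 1) h2
    have := hτT (i + 1 + 1) (by omega)
    have := hτ0 i
    have := h_nonneg i
    have := h_nonneg (i + 1 + 1)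
    constructor <;> linarith
  have hhi0 : ∀ j ≤ m, (0 : ℝ) ≤ τ j + h j := fun j _ => add_nonneg (hτ0 j) (h_nonneg j)
  have hhiT : ∀ j ≤ m, (τ j : ℝ) + h j ≤ T := fun j hj => by
    linarith [h_sep j hj, h_nonneg (j + 1), hτT (j + 1) (by omega)]
  have hlo0 : ∀ j ≤ m, (0 : ℝ) ≤ τ (j + 1) - h (j + 1) := fun j hj => by
    linarith [h_sep j hj, h_nonneg j, hτ0 j]
  have hloT : ∀ j ≤ m, (τ (j + 1) : ℝ) - h (j + 1) ≤ T := fun j hj => by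
    linarith [h_nonneg (j + 1), hτT (j + 1) (by omega)]
  let X := fun y a b => exceedance T Z y a b
  let R := fun x => realAnchoredExceedance T Z A x
  let E₁ := ⋃ j ∈ Finset.range (m + 1), X F (τ j + h j) (τ (j + 1) - h (j + 1))
  let E₂ := ⋃ j ∈ Finset.Icc 1 m, (X F (τ j - h j) (τ j) ∪ X F (τ j) (τ j + h j))
  let E₃ := ⋃ j ∈ Finset.Icc 1 m, ⋃ d ∈ Finset.Icc 1 ⌊h j⌋₊,
    ((X D (τ j - h j) (τ j - (d : ℕ)) ∪ X D (τ j - (d : ℕ)) (τ j)) ∪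
      (X D (τ j) (τ j + (d : ℕ)) ∪ X D (τ j + (d : ℕ)) (τ j + h j)))
  let E₄ := ⋃ j ∈ Finset.Icc 1 m,
    ⋃ d ∈ Finset.range (⌊h j⌋₊ + 1) ×ˢ Finset.range (⌊h j⌋₊ + 1),
      (X B (τ j - (d.1 : ℕ)) (τ j - (d.2 : ℕ)) ∪ X B (τ j + (d.1 : ℕ)) (τ j + (d.2 : ℕ)))
  let E₅ := ⋃ j ∈ Finset.range (m + 1), (R (τ j + h j) ∪ R (τ (j + 1) - h (j + 1)))
  let E₆ := ⋃ j ∈ Finset.Icc 1 m, R (τ j)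
  let E₇ := ⋃ s ∈ Finset.range (T + 1), anchoredExceedance T Z β s
  have hfl : ∀ j, (⌊h j⌋₊ : ℝ) ≤ h j := fun j => Nat.floor_le (h_nonneg j)
  have union2 : ∀ {U V : Set Ω} {p q : ℝ}, P.real U ≤ p → P.real V ≤ q →
      P.real (U ∪ V) ≤ p + q := fun hU hV => (measureReal_union_le _ _).trans (add_le_add hU hV)
  have hR : ∀ x, P.real (R x) ≤ 8 * K * Real.exp (-A / (2 * r)) := fun x =>
    (union2 (hZ.measureReal_anchoredExceedance_le hA0 hr hK)
      (hZ.measureReal_anchoredExceedance_le hA0 hr hK)).trans (le_of_eq (by ring))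
  have p₁ : P.real E₁ ≤ (m + 1 : ℕ) * (2 * Real.exp (-F / 2)) := by
    refine (measureReal_biUnion_le_card_mul _ fun j hj => ?_).trans_eq (by rw [Finset.card_range])
    have hj' := Nat.lt_succ_iff.1 (Finset.mem_range.1 hj)
    exact hZ.measureReal_exceedance_le hF0 (hhi0 j hj') (hhiT j hj') (hlo0 j hj') (hloT j hj')
  have p₂ : P.real E₂ ≤ m * (2 * Real.exp (-F / 2) + 2 * Real.exp (-F / 2)) := by
    refine (measureReal_biUnion_le_card_mul _ fun j hj => ?_).trans_eq
      (by rw [Nat.card_Icc, Nat.add_sub_cancel])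
    obtain ⟨l0, lT⟩ := hlo j hj
    have hjT := hτT j ((Finset.mem_Icc.1 hj).2.trans (by omega))
    have := h_nonneg j
    exact union2 (hZ.measureReal_exceedance_le hF0 l0 (by linarith) (hτ0 j) hjT)
      (hZ.measureReal_exceedance_le hF0 (hτ0 j) hjT (by linarith) lT)
  have p₃ : P.real E₃ ≤ m * (H * (8 * Real.exp (-D / 2))) := by
    refine (measureReal_biUnion_le_card_mul _ fun j hj => ?_).trans_eq
      (by rw [Nat.card_Icc, Nat.add_sub_cancel])
    refine (measureReal_biUnion_le_card_mul (c := 8 * Real.exp (-D / 2)) _ fun d hd => ?_).trans ?_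
    · obtain ⟨l0, lT⟩ := hlo j hj
      have hjT := hτT j ((Finset.mem_Icc.1 hj).2.trans (by omega))
      have := h_nonneg j
      have hd0 : (0 : ℝ) ≤ d := Nat.cast_nonneg d
      have hdh : (d : ℝ) ≤ h j :=
        le_trans (by exact_mod_cast (Finset.mem_Icc.1 hd).2) (hfl j)
      refine (union2 (union2
        (hZ.measureReal_exceedance_le hD0 l0 (by linarith) (by linarith) (by linarith))
        (hZ.measureReal_exceedance_le hD0 (by linarith) (by linarith) (hτ0 j) hjT))
        (union2 (hZ.measureReal_exceedance_le hD0 (hτ0 j) hjT (by linarith) (by linarith))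
        (hZ.measureReal_exceedance_le hD0 (by linarith) (by linarith) (by linarith) lT))).trans_eq
        (by ring)
    · rw [Nat.card_Icc, Nat.add_sub_cancel]
      gcongr
      exact (hfl j).trans (h_le j)
  have p₄ : P.real E₄ ≤ m * ((H + 1) ^ 2 * (4 * Real.exp (-B / 2))) := by
    refine (measureReal_biUnion_le_card_mul _ fun j hj => ?_).trans_eq
      (by rw [Nat.card_Icc, Nat.add_sub_cancel])
    refine (measureReal_biUnion_le_card_mul (c := 4 * Real.exp (-B / 2)) _ fun d hd => ?_).trans ?_
    · obtain ⟨l0, lT⟩ := hlo j hj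
      have := h_nonneg j
      obtain ⟨m1, m2⟩ := Finset.mem_product.1 hd
      have hd1 : ((d.1 : ℕ) : ℝ) ≤ h j :=
        le_trans (by exact_mod_cast Nat.lt_succ_iff.1 (Finset.mem_range.1 m1)) (hfl j)
      have hd2 : ((d.2 : ℕ) : ℝ) ≤ h j :=
        le_trans (by exact_mod_cast Nat.lt_succ_iff.1 (Finset.mem_range.1 m2)) (hfl j)
      have hd1' : (0 : ℝ) ≤ d.1 := Nat.cast_nonneg _
      have hd2' : (0 : ℝ) ≤ d.2 := Nat.cast_nonneg _
      refine (union2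
        (hZ.measureReal_exceedance_le hB0 (by linarith) (by linarith) (by linarith) (by linarith))
        (hZ.measureReal_exceedance_le hB0 (by linarith) (by linarith) (by linarith)
          (by linarith))).trans_eq (by ring)
    · rw [Finset.card_product, Finset.card_range]
      push_cast
      rw [← sq]
      gcongr
      exact (hfl j).trans (h_le j)
  have p₅ : P.real E₅ ≤ (m + 1 : ℕ) *
      (8 * K * Real.exp (-A / (2 * r)) + 8 * K * Real.exp (-A / (2 * r))) :=
    (measureReal_biUnion_le_card_mul _ fun j _ => union2 (hR _) (hR _)).trans_eq
      (by rw [Finset.card_range])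
  have p₆ : P.real E₆ ≤ m * (8 * K * Real.exp (-A / (2 * r))) :=
    (measureReal_biUnion_le_card_mul _ fun j _ => hR _).trans_eq (by simp)
  have p₇ : P.real E₇ ≤ (T + 1 : ℕ) * (4 * K * Real.exp (-β / (2 * r))) :=
    (measureReal_biUnion_le_card_mul _ fun s _ =>
      hZ.measureReal_anchoredExceedance_le hβ0 hr hK).trans_eq (by rw [Finset.card_range])
  refine ⟨E₁ ∪ E₂ ∪ E₃ ∪ E₄ ∪ E₅ ∪ E₆ ∪ E₇, ?_, fun ω hω => ?_⟩
  · refine (union2 (union2 (union2 (union2 (union2 (union2 p₁ p₂) p₃) p₄) p₅) p₆) p₇).trans_eq ?_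
    push_cast
    ring
  simp only [Set.mem_union, not_or] at hω
  obtain ⟨⟨⟨⟨⟨⟨n₁, n₂⟩, n₃⟩, n₄⟩, n₅⟩, n₆⟩, n₇⟩ := hω
  simp only [E₁, E₂, E₃, E₄, E₅, E₆, E₇, Set.mem_iUnion, not_exists, Set.mem_union, not_or]
    at n₁ n₂ n₃ n₄ n₅ n₆ n₇
  set z : ℕ → ℝ := fun t => Z t ω with hz
  have sq_le : ∀ {y a b : ℝ}, a ≤ b → ω ∉ X y a b →
      (stepIntegral T z b - stepIntegral T z a) ^ 2 ≤ y * (b - a) := by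
    intro y a b hab hX
    have := le_of_notMem_exceedance hX
    rwa [abs_of_nonneg (sub_nonneg.2 hab)] at this
  have leT : ∀ {u : ℕ} {b : ℝ}, b ≤ T → (u : ℝ) ≤ b → u ≤ T := fun h1 h2 => by
    exact_mod_cast h2.trans h1
  have left : ∀ j, ∀ u : ℕ, (τ j : ℝ) - h j ≤ u → (u : ℝ) ≤ τ j →
      ∃ d ≤ ⌊h j⌋₊, (u : ℝ) = τ j - (d : ℕ) := by
    intro j u h1 h2
    have h2' : u ≤ τ j := by exact_mod_cast h2
    refine ⟨τ j - u, Nat.le_floor ?_, ?_⟩ <;> rw [Nat.cast_sub h2'] <;> linarith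
  have right : ∀ j, ∀ u : ℕ, (τ j : ℝ) ≤ u → (u : ℝ) ≤ τ j + h j →
      ∃ d ≤ ⌊h j⌋₊, (u : ℝ) = τ j + (d : ℕ) := by
    intro j u h1 h2
    have h1' : τ j ≤ u := by exact_mod_cast h1
    refine ⟨u - τ j, Nat.le_floor ?_, ?_⟩ <;> rw [Nat.cast_sub h1'] <;> linarith
  have leftB : ∀ j ∈ Finset.Icc 1 m, ∀ u v : ℕ, (τ j : ℝ) - h j ≤ u → u ≤ v → (v : ℝ) ≤ τ j →
      (stepIntegral T z v - stepIntegral T z u) ^ 2 ≤ B * (v - u) := by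
    intro j hj u v h1 h2 h3
    have h2' : (u : ℝ) ≤ v := by exact_mod_cast h2
    obtain ⟨d, hd, hdu⟩ := left j u h1 (h2'.trans h3)
    obtain ⟨d', hd', hdv⟩ := left j v (h1.trans h2') h3
    refine sq_le h2' ?_
    rw [hdu, hdv]
    exact (n₄ j hj (d, d') (Finset.mem_product.2
      ⟨Finset.mem_range.2 (Nat.lt_succ_of_le hd), Finset.mem_range.2 (Nat.lt_succ_of_le hd')⟩)).1
  have rightB : ∀ j ∈ Finset.Icc 1 m, ∀ u v : ℕ, (τ j : ℝ) ≤ u → u ≤ v → (v : ℝ) ≤ τ j + h j →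
      (stepIntegral T z v - stepIntegral T z u) ^ 2 ≤ B * (v - u) := by
    intro j hj u v h1 h2 h3
    have h2' : (u : ℝ) ≤ v := by exact_mod_cast h2
    obtain ⟨d, hd, hdu⟩ := right j u h1 (h2'.trans h3)
    obtain ⟨d', hd', hdv⟩ := right j v (h1.trans h2') h3
    refine sq_le h2' ?_
    rw [hdu, hdv]
    exact (n₄ j hj (d, d') (Finset.mem_product.2
      ⟨Finset.mem_range.2 (Nat.lt_succ_of_le hd), Finset.mem_range.2 (Nat.lt_succ_of_le hd')⟩)).2
  have wl : ∀ j ∈ Finset.Icc 1 m, (stepIntegral T z (τ j) - stepIntegral T z (τ j - h j)) ^ 2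
      ≤ F * (τ j - (τ j - h j)) := fun j hj => sq_le (by linarith [h_nonneg j]) (n₂ j hj).1
  have wr : ∀ j ∈ Finset.Icc 1 m, (stepIntegral T z (τ j + h j) - stepIntegral T z (τ j)) ^ 2
      ≤ F * (τ j + h j - τ j) := fun j hj => sq_le (by linarith [h_nonneg j]) (n₂ j hj).2
  refine ⟨fun j hj => ?_, fun j hj => ?_, fun j hj => ?_, fun j hj => ?_, fun j hj => ?_⟩
  · have n5 := n₅ j (Finset.mem_range.2 (Nat.lt_succ_iff.2 hj))
    have s := h_sep j hj
    refine ⟨sq_le (by linarith) (n₁ j (Finset.mem_range.2 (Nat.lt_succ_iff.2 hj))),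
      fun u h1 h2 => ?_, fun u h1 h2 => ?_, fun u v h1 h2 h3 => ?_⟩
    · exact (le_of_notMem_realAnchoredExceedance (hhi0 j hj) n5.1 (leT (hloT j hj) h2)).1 h1
    · exact (le_of_notMem_realAnchoredExceedance (hlo0 j hj) n5.2 (leT (hloT j hj) h2)).2 h2
        (hloT j hj)
    · have hv := leT (hloT j hj) h3
      have hu := h2.trans hv
      exact sq_le (by exact_mod_cast h2) fun hX =>
        n₇ u (Finset.mem_range.2 (Nat.lt_succ_iff.2 hu)) ⟨hu, v, hv, hX⟩
  · obtain ⟨h1, h2⟩ := Finset.mem_Icc.1 hj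
    obtain ⟨i, rfl⟩ : ∃ i, j = i + 1 := ⟨j - 1, by omega⟩
    have n5 := (n₅ i (Finset.mem_range.2 (by omega))).2
    have hjT := hτT (i + 1) (by omega)
    refine ⟨wl _ hj, fun u h1 h2 => ?_, fun u h1 h2 => ?_, leftB _ hj⟩
    · exact (le_of_notMem_realAnchoredExceedance (hlo _ hj).1 n5 (leT hjT h2)).1 h1
    · exact (le_of_notMem_realAnchoredExceedance (hτ0 _) (n₆ _ hj) (leT hjT h2)).2 h2 hjT
  · refine ⟨wl _ hj, fun u h1 h2 => ?_, fun u h1 h2 => ?_, leftB _ hj⟩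
    · obtain ⟨d, hd, hdu⟩ := left j u h1 h2
      rcases d.eq_zero_or_pos with rfl | hpos
      · rw [Nat.cast_zero, sub_zero] at hdu
        rw [hdu]
        exact (wl j hj).trans (mul_le_mul_of_nonneg_right hFD (by linarith [h_nonneg j]))
      · refine sq_le h1 ?_
        rw [hdu]
        exact (n₃ j hj d (Finset.mem_Icc.2 ⟨hpos, hd⟩)).1.1
    · obtain ⟨d, hd, hdu⟩ := left j u h1 h2
      rcases d.eq_zero_or_pos with rfl | hpos
      · rw [Nat.cast_zero, sub_zero] at hdu
        rw [hdu]; simp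
      · refine sq_le h2 ?_
        rw [hdu]
        exact (n₃ j hj d (Finset.mem_Icc.2 ⟨hpos, hd⟩)).1.2
  · have n5 := (n₅ j (Finset.mem_range.2 (by have := (Finset.mem_Icc.1 hj).2; omega))).1
    have hjT := (hlo _ hj).2
    refine ⟨wr _ hj, fun u h1 h2 => ?_, fun u h1 h2 => ?_, rightB _ hj⟩
    · exact (le_of_notMem_realAnchoredExceedance (hτ0 _) (n₆ _ hj) (leT hjT h2)).1 h1
    · exact (le_of_notMem_realAnchoredExceedance (by linarith [hτ0 j, h_nonneg j]) n5
        (leT hjT h2)).2 h2 hjT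
  · refine ⟨wr _ hj, fun u h1 h2 => ?_, fun u h1 h2 => ?_, rightB _ hj⟩
    · obtain ⟨d, hd, hdu⟩ := right j u h1 h2
      rcases d.eq_zero_or_pos with rfl | hpos
      · rw [Nat.cast_zero, add_zero] at hdu
        rw [hdu]; simp
      · refine sq_le h1 ?_
        rw [hdu]
        exact (n₃ j hj d (Finset.mem_Icc.2 ⟨hpos, hd⟩)).2.1
    · obtain ⟨d, hd, hdu⟩ := right j u h1 h2
      rcases d.eq_zero_or_pos with rfl | hpos
      · rw [Nat.cast_zero, add_zero] at hdu
        rw [hdu]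
        exact (wr j hj).trans (mul_le_mul_of_nonneg_right hFD (by linarith [h_nonneg j]))
      · refine sq_le h2 ?_
        rw [hdu]
        exact (n₃ j hj d (Finset.mem_Icc.2 ⟨hpos, hd⟩)).2.2

end

/-! ### Gaussian noise -/

/-- Standardised independent Gaussian variables agree almost surely with a noise sequence. -/
theorem exists_isNoise {Ω : Type*} [MeasurableSpace Ω] {P : Measure Ω} [IsProbabilityMeasure P]
    {σ : ℝ} (hσ : 0 < σ) {T : ℕ} {e : ℕ → Ω → ℝ}
    (hlaw : ∀ t ∈ Finset.Icc 1 T, HasLaw (e t) (gaussianReal 0 (Real.toNNReal (σ ^ 2))) P)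
    (hind : iIndepFun (fun (t : Finset.Icc 1 T) => e t) P) :
    ∃ Z : ℕ → Ω → ℝ, IsNoise P Z ∧ ∀ᵐ ω ∂P, ∀ t ∈ Finset.Icc 1 T, Z t ω = e t ω / σ := by
  have hex : ∀ t, ∃ g : Ω → ℝ, Measurable g ∧ (t ∈ Finset.Icc 1 T → e t =ᵐ[P] g) := by
    intro t
    by_cases ht : t ∈ Finset.Icc 1 T
    · exact ⟨(hlaw t ht).aemeasurable.mk, (hlaw t ht).aemeasurable.measurable_mk,
        fun _ => (hlaw t ht).aemeasurable.ae_eq_mk⟩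
    · exact ⟨0, measurable_zero, fun h => absurd h ht⟩
  choose g hgm hge using hex
  have hmgf : ∀ t ∈ Finset.Icc 1 T, ∀ l, mgf (fun ω => g t ω / σ) P l = Real.exp (l ^ 2 / 2) := by
    intro t ht l
    have h1 := mgf_gaussianReal (((hlaw t ht).congr (hge t ht).symm).map_eq) (l / σ)
    have h2 : mgf (fun ω => g t ω / σ) P l = mgf (g t) P (l / σ) := by
      refine integral_congr_ae (.of_forall fun ω => ?_)
      change Real.exp (l * (g t ω / σ)) = Real.exp (l / σ * g t ω)
      congr 1
      ring
    rw [h2, h1, Real.coe_toNNReal _ (sq_nonneg σ)]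
    congr 1
    field_simp
    ring
  have hsub : ∀ t ∈ Finset.Icc 1 T, HasSubgaussianMGF (fun ω => g t ω / σ) 1 P := by
    intro t ht
    refine ⟨fun l => ?_, fun l => by rw [hmgf t ht]; simp⟩
    by_contra hint
    exact (Real.exp_pos _).ne' ((hmgf t ht l).symm.trans (mgf_undef hint))
  refine ⟨fun t ω => if t ∈ Finset.Icc 1 T then g t ω / σ else 0, ⟨fun t => ?_, ?_, fun t => ?_,
    fun t l => ?_⟩, ?_⟩
  · by_cases ht : t ∈ Finset.Icc 1 T
    · simpa only [ht, if_true] using (hgm t).div_const σ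
    · simpa only [ht, if_false] using measurable_const
  · refine iIndepFun_extend_zero (e := fun t ω => g t ω / σ) ?_
    exact (hind.congr fun t : Finset.Icc 1 T => hge t t.2).comp (fun _ x => x / σ)
      fun _ => measurable_id.div_const σ
  · by_cases ht : t ∈ Finset.Icc 1 T
    · simpa only [ht, if_true] using hsub t ht
    · simp only [ht, if_false]
      refine ⟨fun l => by simp, fun l => ?_⟩
      simp only [mgf, mul_zero, Real.exp_zero, integral_const, probReal_univ, smul_eq_mul, mul_one]
      exact Real.one_le_exp (by positivity)
  · by_cases ht : t ∈ Finset.Icc 1 T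
    · simp only [ht, if_true, hmgf t ht]
      exact Real.one_le_exp (by positivity)
    · simp [ht, mgf]
  · have : ∀ᵐ ω ∂P, ∀ t ∈ Finset.Icc 1 T, e t ω = g t ω :=
      (ae_ball_iff (Finset.countable_toSet _)).2 fun t ht => hge t ht
    filter_upwards [this] with ω hω t ht
    rw [if_pos ht, hω t ht]

/-! ### Choice of the levels -/

/-- A power of `T` beats an affine function of `log T`. -/
theorem eventually_log_le_rpow (a b : ℝ) {s : ℝ} (hs : 0 < s) :
    ∀ᶠ T : ℕ in Filter.atTop, a * Real.log T + b ≤ (T : ℝ) ^ s := by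
  have h1 : (fun x : ℝ => a * Real.log x + b) =o[Filter.atTop] fun x : ℝ => x ^ s :=
    ((isLittleO_log_rpow_atTop hs).const_mul_left a).add
      ((Asymptotics.isLittleO_const_left (c := b)).2
        (Or.inr (tendsto_norm_atTop_atTop.comp (tendsto_rpow_atTop hs))))
  have h2 := h1.bound one_pos
  have h3 := tendsto_natCast_atTop_atTop (R := ℝ) |>.eventually h2
  filter_upwards [h3] with T hT
  have : 0 ≤ (T : ℝ) ^ s := Real.rpow_nonneg (Nat.cast_nonneg T) s
  rw [one_mul, Real.norm_of_nonneg this] at hT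
  exact (le_abs_self _).trans hT

/-- The inequalities between the levels: a wrong number of fitted changepoints on one cell costs at
least `(1 + 3 ε / 8) L`, which exceeds the sum of what the noise can gain on all other cells. -/
theorem levels_ineq {ε L m x : ℝ} (hε : 0 < ε) (hL : 0 < L) (hm : 1 ≤ m)
    (hx : x = ε / (32 * m + 16)) :
    (m + 1) * (2 * x * L) + m * (2 * x * L + 2 * (2 * (1 / (4 * m + 3) + 2 * x) * L))
      < (1 + 3 * ε / 8) * L ∧
    (1 + 3 * ε / 8) * L ≤ (2 + ε) * L - 2 * ((1 / 16 + ε / 8) * L) ∧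
    (1 + 3 * ε / 8) * L ≤ (2 + ε) * L -
      (2 * x * L + 2 * ((1 / 16 + ε / 8) * L) + (7 / 8 + ε / 4) * L) ∧
    (1 + 3 * ε / 8) * L ≤ 3 / 8 * ((8 + 5 * ε) * L) - 8 * (2 * x * L) - (2 + ε) * L := by
  have hx0 : 0 < x := by rw [hx]; positivity
  have hxm : x * (32 * m + 16) = ε := by rw [hx]; field_simp
  have hx48 : 48 * x ≤ ε := by nlinarith
  have hεL : 0 < ε * L := by positivity
  have hxL : 48 * (x * L) ≤ ε * L := by nlinarith
  have hq : m * (1 / (4 * m + 3)) < 1 / 4 := by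
    rw [mul_one_div, div_lt_div_iff₀ (by linarith) (by norm_num)]
    linarith
  refine ⟨?_, by linarith, by linarith, by linarith⟩
  rw [show (m + 1) * (2 * x * L) + m * (2 * x * L + 2 * (2 * (1 / (4 * m + 3) + 2 * x) * L))
    = (4 * (m * (1 / (4 * m + 3))) + x * (12 * m + 2)) * L by ring]
  exact mul_lt_mul_of_pos_right (by nlinarith) hL

/-- Sum of the probabilities of the exceptional events. Only the one for the whole cells is of the
exact order `T ^ (-x)`; the others are smaller by a power of `T`, or at least by the factor
`T ^ (-x) ≤ 1 / 10`. -/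
theorem exceptional_probability_le {ε T L m x K H r : ℝ} (hε : 0 < ε) (hT : 1 ≤ T)
    (hL : L = Real.log T) (hm : 1 ≤ m) (hx : x = ε / (32 * m + 16))
    (hr : r = (4 + 2 * ε) / (4 + ε)) (hK : 0 ≤ K) (hH0 : 0 ≤ H)
    (hH : H ≤ T ^ (1 / (4 * m + 3)) / 4)
    (h10 : T ^ (-x) ≤ 1 / 10) (hTB : 80 ≤ T ^ (1 / 10 : ℝ))
    (hTA : 200 * K ≤ T ^ (1 / 64 : ℝ)) (hTI : 40 * K ≤ T ^ (ε / 8)) :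
    (3 * m + 1) * (2 * Real.exp (-(2 * x * L) / 2))
      + m * (H * (8 * Real.exp (-(2 * (1 / (4 * m + 3) + 2 * x) * L) / 2)))
      + m * ((H + 1) ^ 2 * (4 * Real.exp (-((7 / 8 + ε / 4) * L) / 2)))
      + (3 * m + 2) * (8 * K * Real.exp (-((1 / 16 + ε / 8) * L) / (2 * r)))
      + (T + 1) * (4 * K * Real.exp (-((2 + ε) * L) / (2 * r))) ≤ (7 * m + 3) * T ^ (-x) := by
  have hT0 : 0 < T := by linarith
  have hx0 : 0 < x := by rw [hx]; positivity
  have hxm : x * (32 * m + 16) = ε := by rw [hx]; field_simp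
  have hx48 : 48 * x ≤ ε := by nlinarith
  have hr1 : 0 < r := by rw [hr]; positivity
  have hr2 : r ≤ 2 := by rw [hr, div_le_iff₀ (by linarith)]; linarith
  have hexp : ∀ a, Real.exp (a * L) = T ^ a := fun a => by
    rw [Real.rpow_def_of_pos hT0, hL, mul_comm]
  have mono : ∀ {a b : ℝ}, a ≤ b → T ^ a ≤ T ^ b := fun h => Real.rpow_le_rpow_of_exponent_le hT h
  have pos : ∀ a : ℝ, 0 < T ^ a := fun a => Real.rpow_pos_of_pos hT0 a
  set p := T ^ (-x) with hp
  have hp0 : 0 < p := pos _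
  set n := T ^ (1 / (4 * m + 3)) with hn
  have hn1 : 1 ≤ n := Real.one_le_rpow hT (by positivity)
  have b1 : (3 * m + 1) * (2 * Real.exp (-(2 * x * L) / 2)) = (6 * m + 2) * p := by
    rw [show -(2 * x * L) / 2 = -x * L by ring, hexp]; ring
  have b2 : m * (H * (8 * Real.exp (-(2 * (1 / (4 * m + 3) + 2 * x) * L) / 2))) ≤ m / 5 * p := by
    rw [show -(2 * (1 / (4 * m + 3) + 2 * x) * L) / 2 = (-(1 / (4 * m + 3)) + -x + -x) * L by ring,
      hexp, Real.rpow_add hT0, Real.rpow_add hT0, Real.rpow_neg hT0.le, ← hn, ← hp]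
    calc m * (H * (8 * (n⁻¹ * p * p))) ≤ m * (n / 4 * (8 * (n⁻¹ * p * (1 / 10)))) := by gcongr
      _ = m / 5 * p := by field_simp; ring
  have b3 : m * ((H + 1) ^ 2 * (4 * Real.exp (-((7 / 8 + ε / 4) * L) / 2))) ≤ m / 5 * p := by
    have h1 : n ≤ T ^ (1 / 7 : ℝ) := mono (by
      rw [div_le_div_iff₀ (by linarith) (by norm_num)]; linarith)
    have h2 : (H + 1) ^ 2 ≤ 4 * T ^ (2 / 7 : ℝ) := by
      calc (H + 1) ^ 2 ≤ (2 * T ^ (1 / 7 : ℝ)) ^ 2 := by gcongr; linarith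
        _ = 4 * T ^ (2 / 7 : ℝ) := by
          rw [mul_pow, ← Real.rpow_natCast (T ^ _), ← Real.rpow_mul hT0.le]; norm_num
    have h3 : T ^ (2 / 7 : ℝ) * T ^ (-(7 / 16 + ε / 8)) * T ^ (1 / 10 : ℝ) ≤ p := by
      rw [← Real.rpow_add hT0, ← Real.rpow_add hT0]
      exact mono (by linarith)
    rw [show -((7 / 8 + ε / 4) * L) / 2 = -(7 / 16 + ε / 8) * L by ring, hexp]
    have h4 : 80 * (T ^ (2 / 7 : ℝ) * T ^ (-(7 / 16 + ε / 8))) ≤ p := by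
      refine le_trans ?_ h3
      rw [mul_comm]
      exact mul_le_mul_of_nonneg_left hTB (mul_pos (pos _) (pos _)).le
    calc m * ((H + 1) ^ 2 * (4 * T ^ (-(7 / 16 + ε / 8))))
        ≤ m * (4 * T ^ (2 / 7 : ℝ) * (4 * T ^ (-(7 / 16 + ε / 8)))) := by
          gcongr
      _ = m / 5 * (80 * (T ^ (2 / 7 : ℝ) * T ^ (-(7 / 16 + ε / 8)))) := by ring
      _ ≤ m / 5 * p := by gcongr
  have b4 : (3 * m + 2) * (8 * K * Real.exp (-((1 / 16 + ε / 8) * L) / (2 * r))) ≤ m / 5 * p := by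
    have h1 : Real.exp (-((1 / 16 + ε / 8) * L) / (2 * r)) ≤ T ^ (-(1 / 64 + ε / 32)) := by
      rw [← hexp]
      have hL0 : 0 ≤ L := by rw [hL]; exact Real.log_nonneg hT
      apply Real.exp_le_exp.2
      rw [neg_div, neg_mul, neg_le_neg_iff, le_div_iff₀ (by positivity)]
      have : (1 / 64 + ε / 32) * L * (2 * r) ≤ (1 / 64 + ε / 32) * L * (2 * 2) := by gcongr
      linarith
    have h2 : T ^ (-(1 / 64 + ε / 32)) * T ^ (1 / 64 : ℝ) ≤ p := by
      rw [← Real.rpow_add hT0]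
      exact mono (by linarith)
    calc (3 * m + 2) * (8 * K * Real.exp (-((1 / 16 + ε / 8) * L) / (2 * r)))
        ≤ (5 * m) * (8 * K * T ^ (-(1 / 64 + ε / 32))) := by gcongr; linarith
      _ = m / 5 * (T ^ (-(1 / 64 + ε / 32)) * (200 * K)) := by ring
      _ ≤ m / 5 * (T ^ (-(1 / 64 + ε / 32)) * T ^ (1 / 64 : ℝ)) := by
          gcongr
      _ ≤ m / 5 * p := by gcongr
  have b5 : (T + 1) * (4 * K * Real.exp (-((2 + ε) * L) / (2 * r))) ≤ m / 5 * p := by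
    have h1 : Real.exp (-((2 + ε) * L) / (2 * r)) = T⁻¹ * T ^ (-(ε / 4)) := by
      rw [← Real.rpow_neg_one, ← Real.rpow_add hT0, ← hexp, hr]
      congr 1
      field_simp
      ring
    have h2 : T ^ (-(ε / 4)) * T ^ (ε / 8) ≤ p := by
      rw [← Real.rpow_add hT0]
      exact mono (by linarith)
    rw [h1]
    calc (T + 1) * (4 * K * (T⁻¹ * T ^ (-(ε / 4))))
        ≤ (2 * T) * (4 * K * (T⁻¹ * T ^ (-(ε / 4)))) := by
          have := pos (-(ε / 4))
          gcongr
          linarith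
      _ = 1 / 5 * (T ^ (-(ε / 4)) * (40 * K)) := by field_simp; ring
      _ ≤ 1 / 5 * (T ^ (-(ε / 4)) * T ^ (ε / 8)) := by
          have := pos (-(ε / 4))
          gcongr
      _ ≤ m / 5 * p := by gcongr
  rw [b1]
  have : (6 * m + 2) * p + m / 5 * p + m / 5 * p + m / 5 * p + m / 5 * p ≤ (7 * m + 3) * p := by
    nlinarith
  linarith

theorem theorem2 (ε : ℝ) (hε : 0 < ε) :
    ∃ T₀ : ℕ, ∀ T : ℕ, T₀ ≤ T →
      ∀ (m : ℕ) (τ : ℕ → ℕ) (θ : ℕ → ℝ) (σ : ℝ),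
        1 ≤ m → IsSegmentation T m τ → 0 < σ →
        (16 + 10 * ε) * Real.log T ≤ minSegmentLength m τ * minJumpSize σ m θ ^ 2 →
        (32 + 20 * ε) * Real.log T / (T : ℝ) ^ (1 / (4 * (m : ℝ) + 3))
          ≤ minJumpSize σ m θ ^ 2 →
        ∀ {Ω : Type*} [MeasurableSpace Ω] (P : Measure Ω) [IsProbabilityMeasure P]
          (e : ℕ → Ω → ℝ),
          (∀ t ∈ Finset.Icc 1 T, HasLaw (e t) (gaussianReal 0 (Real.toNNReal (σ ^ 2))) P) →
          iIndepFun (fun (t : Finset.Icc 1 T) => e t) P →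
          1 - (7 * (m : ℝ) + 3) * (T : ℝ) ^ (-ε / (32 * (m : ℝ) + 16)) ≤
            P.real {ω | ∀ (m' : ℕ) (τ' : ℕ → ℕ),
              IsPenalisedMinimiser T σ ((2 + ε) * Real.log T)
                (fun t => meanSignal m τ θ t + e t ω) m' τ' →
              m' = m ∧ ∀ j ∈ Finset.Icc 1 m,
                |(τ' j : ℝ) - (τ j : ℝ)| * jumpSize σ θ j ^ 2 ≤ (16 + 10 * ε) * Real.log T} := by
  set r : ℝ := (4 + 2 * ε) / (4 + ε) with hr
  have hr1 : 1 < r := by rw [hr, lt_div_iff₀ (by linarith)]; linarith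
  have hlr : 0 < Real.log r := Real.log_pos hr1
  have ev := (((eventually_log_le_rpow 0 80 (by norm_num : (0 : ℝ) < 1 / 10)).and
    (eventually_log_le_rpow (200 / Real.log r) 200 (by norm_num : (0 : ℝ) < 1 / 64))).and
    (eventually_log_le_rpow (40 / Real.log r) 40 (by positivity : 0 < ε / 8))).and
    (Filter.eventually_ge_atTop 2)
  obtain ⟨T₀, hT₀⟩ := Filter.eventually_atTop.1 ev
  refine ⟨T₀, fun T hT m τ θ σ hm hτ hσ hlen hjump Ω _ P _ e hlaw hind => ?_⟩
  obtain ⟨⟨⟨hTB, hTA⟩, hTI⟩, hT2⟩ := hT₀ T hT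
  set L := Real.log T with hL
  have hT2' : (2 : ℝ) ≤ T := by exact_mod_cast hT2
  have hT0 : (0 : ℝ) < T := by linarith
  have hL0 : 0 < L := Real.log_pos (by linarith)
  have hm' : (1 : ℝ) ≤ m := by exact_mod_cast hm
  set x : ℝ := ε / (32 * m + 16) with hx
  have hx0 : 0 < x := by positivity
  rw [show -ε / (32 * (m : ℝ) + 16) = -x by rw [hx, neg_div]]
  -- an error bound of at least `1` claims nothing; otherwise `T ^ (-x)` is at most `1 / 10`
  rcases le_or_gt 1 ((7 * (m : ℝ) + 3) * (T : ℝ) ^ (-x)) with htriv | hnontriv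
  · exact le_trans (by linarith) measureReal_nonneg
  have hp0 : 0 < (T : ℝ) ^ (-x) := Real.rpow_pos_of_pos hT0 _
  have h10 : (T : ℝ) ^ (-x) ≤ 1 / 10 := by nlinarith
  -- the number of scales needed for the maximal inequality with ratio `r`
  set K : ℕ := ⌊L / Real.log r⌋₊ + 1 with hK
  have hKle : (K : ℝ) ≤ L / Real.log r + 1 := by
    rw [hK]
    push_cast
    linarith [Nat.floor_le (by positivity : 0 ≤ L / Real.log r)]
  have hKr : (T : ℝ) < r ^ K := by
    have h1 : L / Real.log r < K := by
      rw [hK]; push_cast; exact Nat.lt_floor_add_one _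
    rw [div_lt_iff₀ hlr] at h1
    rw [← Real.log_lt_log_iff hT0 (by positivity), Real.log_pow]
    exact h1
  -- the half-widths of the windows
  set C : ℝ := (16 + 10 * ε) * L with hC
  have hC0 : 0 < C := by positivity
  set δ := minJumpSize σ m θ with hδ
  have hδle : ∀ j ∈ Finset.Icc 1 m, δ ≤ jumpSize σ θ j := by
    intro j hj
    obtain ⟨h1, h2⟩ := Finset.mem_Icc.1 hj
    obtain ⟨i, rfl⟩ : ∃ i, j = i + 1 := ⟨j - 1, by omega⟩
    exact ciInf_le (Set.finite_range fun j : Fin m => jumpSize σ θ ((j : ℕ) + 1)).bddBelow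
      ⟨i, by omega⟩
  have hlenle : ∀ j ≤ m, minSegmentLength m τ ≤ (τ (j + 1) : ℝ) - τ j := fun j hj =>
    ciInf_le (Set.finite_range fun j : Fin (m + 1) =>
      ((τ ((j : ℕ) + 1) : ℝ) - (τ (j : ℕ) : ℝ))).bddBelow ⟨j, by omega⟩
  have hδ0 : 0 ≤ δ := Real.iInf_nonneg fun j => div_nonneg (abs_nonneg _) hσ.le
  have hδpos : 0 < δ := by
    rcases hδ0.eq_or_lt with h0 | h0
    · rw [← h0] at hlen
      norm_num at hlen
      linarith
    · exact h0
  set h : ℕ → ℝ := fun j => if j ∈ Finset.Icc 1 m then C / (2 * jumpSize σ θ j ^ 2) else 0 with hh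
  have hh_nonneg : ∀ j, 0 ≤ h j := by
    intro j
    simp only [hh]
    split_ifs <;> positivity
  have hh_le : ∀ j, h j ≤ C / (2 * δ ^ 2) := by
    intro j
    simp only [hh]
    split_ifs with hj
    · have := hδle j hj
      gcongr
    · positivity
  have hh_mul : ∀ j ∈ Finset.Icc 1 m, h j * jumpSize σ θ j ^ 2 = C / 2 := by
    intro j hj
    have := hδpos.trans_le (hδle j hj)
    simp only [hh, if_pos hj]
    field_simp
  have hsep : ∀ j ≤ m, h j + h (j + 1) ≤ (τ (j + 1) : ℝ) - τ j := by
    intro j hj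
    have h1 : C / δ ^ 2 ≤ minSegmentLength m τ := (div_le_iff₀ (by positivity)).2 hlen
    have h2 : C / (2 * δ ^ 2) + C / (2 * δ ^ 2) = C / δ ^ 2 := by field_simp; ring
    linarith [hh_le j, hh_le (j + 1), hlenle j hj]
  have hH : C / (2 * δ ^ 2) ≤ (T : ℝ) ^ (1 / (4 * (m : ℝ) + 3)) / 4 := by
    rw [div_le_iff₀ (Real.rpow_pos_of_pos hT0 _)] at hjump
    rw [div_le_div_iff₀ (by positivity) (by norm_num)]
    linarith
  obtain ⟨Z, hZ, hae⟩ := exists_isNoise hσ hlaw hind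
  obtain ⟨hG, hG₁, hG₂, hG₃⟩ := levels_ineq hε hL0 hm' hx
  have hx48 : 48 * x ≤ ε := by
    have : x * (32 * m + 16) = ε := by rw [hx]; field_simp
    nlinarith
  have hF0 : 0 ≤ 2 * x * L := by positivity
  have hA0 : 0 ≤ (1 / 16 + ε / 8) * L := by positivity
  have hD0 : 0 ≤ 2 * (1 / (4 * (m : ℝ) + 3) + 2 * x) * L := by positivity
  have hFD : 2 * x * L ≤ 2 * (1 / (4 * (m : ℝ) + 3) + 2 * x) * L := by
    have : 0 ≤ 1 / (4 * (m : ℝ) + 3) := by positivity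
    gcongr
    linarith
  have hεL : 0 < ε * L := by positivity
  have hAB : 2 * ((1 / 16 + ε / 8) * L) ≤ (7 / 8 + ε / 4) * L := by linarith
  have hBβ : (7 / 8 + ε / 4) * L ≤ (2 + ε) * L := by linarith
  obtain ⟨E, hE, hgood⟩ := hZ.exists_event_cellNoise (K := K) (F := 2 * x * L)
    (A := (1 / 16 + ε / 8) * L) (D := 2 * (1 / (4 * (m : ℝ) + 3) + 2 * x) * L)
    (B := (7 / 8 + ε / 4) * L) (β := (2 + ε) * L) hτ hh_nonneg hh_le hsep
    hF0 hA0 hFD (by positivity) (by positivity) hr1 hKr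
  have hprob := hE.trans (exceptional_probability_le hε (by linarith) hL hm' hx hr
    (Nat.cast_nonneg K) (by positivity) hH h10 (by linarith)
    (le_trans (by linarith [mul_le_mul_of_nonneg_left hKle (by norm_num : (0 : ℝ) ≤ 200),
      (by ring : 200 * (L / Real.log r + 1) = 200 / Real.log r * L + 200)]) hTA)
    (le_trans (by linarith [mul_le_mul_of_nonneg_left hKle (by norm_num : (0 : ℝ) ≤ 40),
      (by ring : 40 * (L / Real.log r + 1) = 40 / Real.log r * L + 40)]) hTI))
  set S := {ω | ∀ (m' : ℕ) (τ' : ℕ → ℕ),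
              IsPenalisedMinimiser T σ ((2 + ε) * L)
                (fun t => meanSignal m τ θ t + e t ω) m' τ' →
              m' = m ∧ ∀ j ∈ Finset.Icc 1 m,
                |(τ' j : ℝ) - (τ j : ℝ)| * jumpSize σ θ j ^ 2 ≤ C} with hS
  have hmain : ∀ ω, ω ∉ E → (∀ t ∈ Finset.Icc 1 T, Z t ω = e t ω / σ) → ω ∈ S := by
    intro ω hωE hωZ m' τ' hmin
    obtain ⟨c₁, c₂, c₃, c₄, c₅⟩ := hgood ω hωE
    obtain ⟨φ, hφ⟩ := hmin.sum_excess_le hσ hτ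
    have hφ' : ∑ t ∈ Finset.Ioc 0 T, excess (meanSignal m' τ' φ)
        (meanSignal m τ fun j => θ j / σ) (fun t => Z t ω) t + m' * ((2 + ε) * L)
        ≤ m * ((2 + ε) * L) := by
      refine le_trans (le_of_eq ?_) hφ
      congr 1
      refine Finset.sum_congr rfl fun t ht => ?_
      have ht' := Finset.mem_Ioc.1 ht
      rw [excess, excess, hωZ t (Finset.mem_Icc.2 ⟨by omega, ht'.2⟩)]
    have hrec := changepoints_mem_windows (J := (8 + 5 * ε) * L) hτ hmin.1 (by simp [hh])
      (by simp [hh]) hh_nonneg hsep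
      (fun j hj => by
        rw [← sub_div, div_pow, ← sq_abs (θ (j + 1) - θ j), ← div_pow]
        refine le_of_eq ?_
        rw [show (|θ (j + 1) - θ j| / σ) = jumpSize σ θ j from rfl, hh_mul j hj, hC]
        ring)
      hF0 hA0 hD0
      hAB hBβ c₁ c₂ c₃ c₄ c₅ hG hG₁ hG₂ hG₃ hφ'
    refine ⟨hrec.1, fun j hj => ?_⟩
    calc |(τ' j : ℝ) - (τ j : ℝ)| * jumpSize σ θ j ^ 2 ≤ h j * jumpSize σ θ j ^ 2 := by
          have := hrec.2 j hj
          gcongr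
      _ = C / 2 := hh_mul j hj
      _ ≤ C := by linarith
  -- no measurability of the event is needed
  have hcover : P.real Set.univ ≤ P.real (S ∪ E) := by
    refine ENNReal.toReal_mono (measure_ne_top _ _) (measure_mono_ae ?_)
    filter_upwards [hae] with ω hω _
    by_cases hωE : ω ∈ E
    · exact Or.inr hωE
    · exact Or.inl (hmain ω hωE hω)
  rw [probReal_univ] at hcover
  have := hcover.trans (measureReal_union_le S E)
  linarith
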